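/- Let $\mathbb T^3=(\mathbb R/2\pi\mathbb Z)^3$ and, for real-valued $u$ on $\mathbb T^3$, let $\widehat u_k=(2\pi)^{-3}\int_{\mathbb T^3}u\,e^{-ik\cdot x}\,dx$, $\|u\|_{H^s}^2=|\widehat u_0|^2+\sum_{k\ne0}|k|^{2s}|\widehat u_k|^2$, $u_h=u-\widehat u_0$. Let $0<\varkappa<1$, $1<\beta<1/\varkappa$, $m>5/2$ and $\alpha>0$. Then there is $\varepsilon>0$, depending only on $\varkappa,m,\alpha,\beta$, such that the following holds. Let $f\in H^{m+1}$ and $g\in H^m$ have zero mean, and let $a\in C([0,\infty);H^m)$ satisfy $\sup_{t\ge0}\|a(t)\|_{H^m}\le\varepsilon$. Consider the system $$\widehat u_0''+2\varkappa\,\widehat u_0'=e^{-\varkappa t}\widehat F_0,\qquad \partial_t^2u_h+2\varkappa\,\partial_tu_h-\Delta u_h=e^{-\varkappa t}\big(a(1+u)^3-\widehat F_0\big),$$ where $\widehat F_0$ is the mean $(2\pi)^{-3}\int_{\mathbb T^3}a(1+u)^3\,dx$, with $u(0)=f$, $\partial_tu(0)=g$; equivalently, $\partial_t^2u+2\varkappa\,\partial_tu-\Delta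 u=e^{-\varkappa t}a(1+u)^3$. Solutions $u=\widehat u_0+u_h$ on $[0,T)$, $0<T\le\infty$, are taken in $C([0,T);H^{m+1})\cap C^1([0,T);H^m)\cap C^2([0,T);H^{m-1})$. Put $V=(\partial_tu_h+\varkappa u_h,\ \partial_xu_h)$ and $E(t)=\|V(t)\|_{H^m}^2=\|\partial_tu_h+\varkappa u_h\|_{H^m}^2+\|\partial_xu_h\|_{H^m}^2$, and suppose $\|V(0)\|_{H^m}=\alpha$. Then a maximal (non-extendable) solution exists, and for every maximal solution $u$, on $[0,T_{\max})$ say, $$T^*:=\sup\Big\{T\in[0,T_{\max}):\ \sup_{t\in[0,T]}\|u(t)\|_{H^m}\le\alpha\beta\ \text{ and }\ E(T)\le E(0)\Big\}=\infty .$$ -/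

import Mathlib

open Filter Topology MeasureTheory

noncomputable section

namespace DampedWave

/-- The flat torus `𝕋³ = (ℝ/2πℤ)³`. A point `y` of Mathlib's unit torus `(ℝ/ℤ)³` stands for the
point `x = 2πy` of `𝕋³`. The Haar probability measure on it is `(2π)⁻³ dx`, and the character
`UnitAddTorus.mFourier k` is `x ↦ exp (i k·x)`. -/
abbrev Torus : Type := UnitAddTorus (Fin 3)

/-- The Fourier coefficient `(2π)⁻³ ∫_{𝕋³} u(x) exp (-i k·x) dx`. -/
def coeff (u : Torus → ℝ) (k : Fin 3 → ℤ) : ℂ :=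
  UnitAddTorus.mFourierCoeff (fun x => (u x : ℂ)) k

/-- The weight of the frequency `k` in the norm of `H^s`: it is `1` for `k = 0`, and `|k|^{2s}`
with the Euclidean length `|k|` for `k ≠ 0`. -/
def weight (s : ℝ) (k : Fin 3 → ℤ) : ℝ :=
  if k = 0 then 1 else (∑ i, (k i : ℝ) ^ 2) ^ s

/-- `u ∈ H^s(𝕋³)`, for `s > 3/2`. For these `s` every element of `H^s` has exactly one continuous
representative, and elements of `H^s` are identified with it. -/
def MemH (s : ℝ) (u : Torus → ℝ) : Prop :=
  Continuous u ∧ Summable (fun k => weight s k * ‖coeff u k‖ ^ 2)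

/-- The norm `(|û₀|² + ∑_{k ≠ 0} |k|^{2s} |û_k|²)^{1/2}` of `H^s`. -/
def hNorm (s : ℝ) (u : Torus → ℝ) : ℝ :=
  Real.sqrt (∑' k, weight s k * ‖coeff u k‖ ^ 2)

/-- The projection `P₀ u = û₀ = (2π)⁻³ ∫_{𝕋³} u dx`. -/
def mean (u : Torus → ℝ) : ℝ :=
  ∫ x, u x ∂(Measure.pi fun _ : Fin 3 => AddCircle.haarAddCircle)

/-- The complementary projection `u_h = (Id - P₀) u`. -/
def homPart (u : Torus → ℝ) : Torus → ℝ := fun x => u x - mean u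

/-- `u` lies in the homogeneous space: `u ∈ H^s` with `û₀ = 0`. -/
def MemHom (s : ℝ) (u : Torus → ℝ) : Prop := MemH s u ∧ mean u = 0

/-- The (classical) partial derivative `∂u/∂x_j`. A shift of `x_j` by `h` is a shift of the `j`-th
unit coordinate by `h / (2π)`. -/
def pderiv (j : Fin 3) (u : Torus → ℝ) : Torus → ℝ := fun x =>
  deriv (fun h : ℝ => u (x + Pi.single j ((h / (2 * Real.pi) : ℝ) : UnitAddCircle))) 0

/-- The Laplacian `Δu = ∑_j ∂_j ∂_j u`. -/
def laplacian (u : Torus → ℝ) : Torus → ℝ := fun x => ∑ j, pderiv j (pderiv j u) x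

/-- `u ∈ C(I; H^s)`. -/
def ContH (s : ℝ) (I : Set ℝ) (u : ℝ → Torus → ℝ) : Prop :=
  (∀ t ∈ I, MemH s (u t)) ∧
  ∀ t ∈ I, Tendsto (fun τ => hNorm s (fun x => u τ x - u t x)) (𝓝[I] t) (𝓝 0)

/-- For `u`, `v` with values in `H^s` on `I`: `v` is the time derivative of `u` on `I`, in the
norm of `H^s` (one-sided at endpoints that belong to `I`). -/
def HasTimeDeriv (s : ℝ) (I : Set ℝ) (u v : ℝ → Torus → ℝ) : Prop :=
  ∀ t ∈ I, Tendsto (fun τ => hNorm s (fun x => (u τ x - u t x) / (τ - t) - v t x))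
    (𝓝[I \ {t}] t) (𝓝 0)

/-- The time interval `[0, T)`, `T ≤ ∞`. -/
def timeInterval (T : EReal) : Set ℝ := {t : ℝ | 0 ≤ t ∧ (t : EReal) < T}

/-- `a(t,·) (1 + u)³`. -/
def source (a : ℝ → Torus → ℝ) (t : ℝ) (u : Torus → ℝ) : Torus → ℝ :=
  fun x => a t x * (1 + u x) ^ 3

/-- `u = û₀ + u_h`, with `∂_t u = ut`, solves on `[0, T)` the system
`û₀'' + 2κ û₀' = e^{-κt} F̂₀`,
`∂_t² u_h + 2κ ∂_t u_h - Δ u_h = e^{-κt} (a (1 + u)³ - F̂₀)`, where `F̂₀ = P₀(a (1 + u)³)`,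
with `u(0) = f` and `∂_t u(0) = g`, in the class
`C([0,T); H^{m+1}) ∩ C¹([0,T); H^m) ∩ C²([0,T); H^{m-1})`. -/
structure IsSolution (κ m : ℝ) (a : ℝ → Torus → ℝ) (f g : Torus → ℝ) (T : EReal)
    (u ut : ℝ → Torus → ℝ) : Prop where
  pos : 0 < T
  init : u 0 = f
  init_deriv : ut 0 = g
  cont : ContH (m + 1) (timeInterval T) u
  cont_deriv : ContH m (timeInterval T) ut
  hasDeriv : HasTimeDeriv m (timeInterval T) u ut
  equation : ∃ utt : ℝ → Torus → ℝ,
    ContH (m - 1) (timeInterval T) utt ∧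
    HasTimeDeriv (m - 1) (timeInterval T) ut utt ∧
    ∀ t ∈ timeInterval T,
      mean (utt t) + 2 * κ * mean (ut t) = Real.exp (-κ * t) * mean (source a t (u t)) ∧
      ∀ x, homPart (utt t) x + 2 * κ * homPart (ut t) x - laplacian (homPart (u t)) x =
        Real.exp (-κ * t) * (source a t (u t) x - mean (source a t (u t)))

/-- `u` on `[0, Tmax)` is a solution that has no extension to a solution on a longer interval. -/
def IsMaximalSolution (κ m : ℝ) (a : ℝ → Torus → ℝ) (f g : Torus → ℝ) (Tmax : EReal)
    (u ut : ℝ → Torus → ℝ) : Prop :=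
  IsSolution κ m a f g Tmax u ut ∧
  ∀ (T : EReal) (w wt : ℝ → Torus → ℝ), Tmax < T → IsSolution κ m a f g T w wt →
    ¬ ∀ t ∈ timeInterval Tmax, w t = u t

/-- `‖V‖²_{H^m} = ‖∂_t u_h + κ u_h‖²_{H^m} + ‖∂_x u_h‖²_{H^m}` for `V = (∂_t u_h + κ u_h, ∂_x u_h)`,
as a function of `u` and `ut = ∂_t u` at one time. -/
def energy (κ m : ℝ) (u ut : Torus → ℝ) : ℝ :=
  hNorm m (fun x => homPart ut x + κ * homPart u x) ^ 2 +
    ∑ j, hNorm m (pderiv j (homPart u)) ^ 2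

/-- `T* = sup {T : sup_{[0,T]} ‖u(t)‖_{H^m} ≤ α β and E(T) ≤ E(0)}`, where `T` ranges over the
times in the interval of existence `[0, Tmax)` of `u`, and `α = ‖V(0)‖_{H^m} = E(0)^{1/2}`. -/
def Tstar (κ m β : ℝ) (Tmax : EReal) (u ut : ℝ → Torus → ℝ) : EReal :=
  sSup {S : EReal | ∃ T : ℝ, S = (T : EReal) ∧ T ∈ timeInterval Tmax ∧
    (∀ t ∈ Set.Icc 0 T, hNorm m (u t) ≤ Real.sqrt (energy κ m (u 0) (ut 0)) * β) ∧
    energy κ m (u T) (ut T) ≤ energy κ m (u 0) (ut 0)}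

end DampedWave

end

noncomputable section

namespace DampedWave

/-! ### Frequencies and weights -/

/-! The damped wave equation is turned into an ordinary differential equation with a Lipschitz right
side on the Hilbert space `Seq` of weighted Fourier coefficients. Let ω be the multiplier max(1,|k|)
and Z = ωu + i(∂_t u + κu), as in `stateOf`. Since -|k|² = -ω² + 1_{k=0}, the equation becomes Z' =
-iωZ - κZ + i(κ²u + P₀u + e^{-κt}F) with F = a(1+u)³. Passing to W = e^{itω}Z removes the only
unbounded term, and u is recovered from Z by the bounded operator `posPart` (ω⁻¹ applied to the real
part). Because H^m is an algebra (`conv`, `enc_source`), the cubic source is locally Lipschitz in u.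
With u retracted onto the ball of radius αβ in the source, the equation is globally Lipschitz and
solvable for all time (`exists_global_solution`).

The real and imaginary parts of a state are orthogonal, so the energy E is exactly the squared norm
of the nonzero modes of Z (`energy_eq`), and e^{itω} preserves it. Suppose the source is bounded by
η in H^m. As |k| ≥ 1 on these modes, `posPart` does not increase the norm. Hence where the norm
equals α, the derivative of half its square is at most -κα² + α(κ²α + η), which is negative for η <
(κ-κ²)α, and this is possible because κ < 1. So E never exceeds α² (`norm_offProj_le_of_solution`).
The mean has zero data and solves a scalar equation with decaying forcing. Two integrations give
|û₀| ≤ η/κ² (`norm_posPart_zero_le_of_solution`). Hence ‖u‖ ≤ α + η/κ² ≤ αβ once η ≤ κ²α(β-1). The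
retraction is then never active, and W yields a genuine global solution
(`exists_global_isSolution`). Both conditions on η hold for small a, which fixes ε (`smallness`).

Conversely, every solution has a state solving the interaction equation
(`IsSolution.hasDerivWithinAt`), and two solutions on a compact time interval solve a common
truncated Lipschitz equation, so solutions are unique (`IsSolution.unique`). A maximal solution must
therefore be the global one, whose bounds make every T ≥ 0 admissible in the supremum. -/

/-- The lattice of frequencies. -/
abbrev Freq : Type := Fin 3 → ℤ

/-- The squared Euclidean length `|k|²`. -/
def normSq (k : Freq) : ℝ := ∑ i, (k i : ℝ) ^ 2

/-- `max 1 |k|`. -/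
def bracket (k : Freq) : ℝ := if k = 0 then 1 else Real.sqrt (normSq k)

theorem normSq_nonneg (k : Freq) : 0 ≤ normSq k := Finset.sum_nonneg fun _ _ => sq_nonneg _

theorem normSq_zero : normSq 0 = 0 := by simp [normSq]

theorem one_le_normSq {k : Freq} (hk : k ≠ 0) : 1 ≤ normSq k := by
  obtain ⟨i, hi⟩ := Function.ne_iff.mp hk
  have h1 : (1 : ℝ) ≤ (k i : ℝ) ^ 2 := by
    have : (1 : ℤ) ≤ (k i) ^ 2 := by
      have : 0 < (k i) ^ 2 := by have : k i ≠ 0 := hi; positivity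
      omega
    exact_mod_cast this
  exact h1.trans (Finset.single_le_sum (f := fun i => (k i : ℝ) ^ 2)
    (fun _ _ => sq_nonneg _) (Finset.mem_univ i))

theorem one_le_bracket (k : Freq) : 1 ≤ bracket k := by
  unfold bracket
  split_ifs with h
  · exact le_rfl
  · exact Real.one_le_sqrt.mpr (one_le_normSq h)

theorem bracket_pos (k : Freq) : 0 < bracket k := one_pos.trans_le (one_le_bracket k)

theorem bracket_zero : bracket 0 = 1 := by simp [bracket]

theorem bracket_sq {k : Freq} (hk : k ≠ 0) : bracket k ^ 2 = normSq k := by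
  rw [bracket, if_neg hk, Real.sq_sqrt (normSq_nonneg k)]

theorem normSq_le_bracket_sq (k : Freq) : normSq k ≤ bracket k ^ 2 := by
  by_cases hk : k = 0
  · subst hk; simp [normSq_zero, bracket_zero]
  · exact (bracket_sq hk).ge

theorem normSq_neg (k : Freq) : normSq (-k) = normSq k := by simp [normSq]

theorem bracket_neg (k : Freq) : bracket (-k) = bracket k := by
  simp [bracket, normSq_neg]

theorem weight_eq (s : ℝ) (k : Freq) : weight s k = (bracket k ^ s) ^ 2 := by
  by_cases hk : k = 0
  · simp [weight, bracket, hk]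
  · rw [weight, bracket, if_neg hk, if_neg hk, ← Real.rpow_natCast, ← Real.rpow_mul
      (Real.sqrt_nonneg _), mul_comm s, Real.rpow_mul (Real.sqrt_nonneg _), Real.rpow_natCast,
      Real.sq_sqrt (normSq_nonneg k), normSq]

theorem abs_le_sqrt_normSq (k : Freq) (i : Fin 3) : |(k i : ℝ)| ≤ Real.sqrt (normSq k) :=
  Real.abs_le_sqrt (Finset.single_le_sum (f := fun i => (k i : ℝ) ^ 2)
    (fun _ _ => sq_nonneg _) (Finset.mem_univ i))

theorem abs_le_bracket (k : Freq) (i : Fin 3) : |(k i : ℝ)| ≤ bracket k := by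
  by_cases hk : k = 0
  · simp [hk, bracket]
  · rw [bracket, if_neg hk]; exact abs_le_sqrt_normSq k i

theorem sqrt_normSq_le_bracket (k : Freq) : Real.sqrt (normSq k) ≤ bracket k :=
  Real.sqrt_le_left (bracket_pos k).le |>.mpr (normSq_le_bracket_sq k)

/-- This is the Euclidean triangle inequality; the value 1 at frequency zero does no harm because
each bracket on the right is at least 1. -/
theorem bracket_add_le (j l : Freq) : bracket (j + l) ≤ bracket j + bracket l := by
  have key : Real.sqrt (normSq (j + l)) ≤ Real.sqrt (normSq j) + Real.sqrt (normSq l) := by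
    have h (k : Freq) : Real.sqrt (normSq k) = ‖WithLp.toLp 2 (fun i => (k i : ℝ))‖ := by
      rw [EuclideanSpace.norm_eq]; simp [normSq]
    rw [h, h, h]
    refine le_trans (le_of_eq ?_) (norm_add_le _ _)
    congr 1
    ext i
    simp
  by_cases h : j + l = 0
  · rw [h, bracket_zero]
    linarith [one_le_bracket j, one_le_bracket l]
  · rw [bracket, if_neg h]
    linarith [sqrt_normSq_le_bracket j, sqrt_normSq_le_bracket l]

theorem bracket_rpow_pos (s : ℝ) (k : Freq) : 0 < bracket k ^ s := Real.rpow_pos_of_pos (bracket_pos k) s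

theorem bracket_rpow_add_le {s : ℝ} (hs : 0 ≤ s) (j l : Freq) :
    bracket (j + l) ^ s ≤ 2 ^ s * (bracket j ^ s + bracket l ^ s) := by
  have hj := bracket_pos j
  have hl := bracket_pos l
  have h1 : bracket (j + l) ≤ 2 * max (bracket j) (bracket l) := by
    linarith [bracket_add_le j l, le_max_left (bracket j) (bracket l),
      le_max_right (bracket j) (bracket l)]
  calc bracket (j + l) ^ s ≤ (2 * max (bracket j) (bracket l)) ^ s :=
        Real.rpow_le_rpow (bracket_pos _).le h1 hs
    _ = 2 ^ s * max (bracket j) (bracket l) ^ s :=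
        Real.mul_rpow (by norm_num) (le_max_of_le_left hj.le)
    _ ≤ 2 ^ s * (bracket j ^ s + bracket l ^ s) := by
        gcongr
        rcases max_choice (bracket j) (bracket l) with h | h <;> rw [h]
        · linarith [bracket_rpow_pos s l]
        · linarith [bracket_rpow_pos s j]

/-- The frequencies form a lattice of rank 3 in ℝ³. The lattice sum is available for the sup norm,
which is at most the Euclidean length, and a negative power reverses the inequality. -/
theorem summable_bracket_rpow {r : ℝ} (hr : r < -3) : Summable fun k : Freq => bracket k ^ r := by
  let L := Submodule.span ℤ (Set.range (Pi.basisFun ℝ (Fin 3)))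
  have hrank : Module.finrank ℤ L = 3 := by
    rw [ZLattice.rank ℝ L]; simp
  have hL : Summable fun z : L => ‖z‖ ^ r :=
    ZLattice.summable_norm_rpow L r (by rw [hrank]; exact_mod_cast hr)
  let φ : Freq → L := fun k => ⟨fun i => (k i : ℝ), by
    have : (fun i => (k i : ℝ)) = ∑ i, k i • Pi.basisFun ℝ (Fin 3) i := by
      ext i; simp [Finset.sum_apply, Pi.single_apply]
    rw [this]
    exact Submodule.sum_mem _ fun i _ =>
      Submodule.smul_mem _ _ (Submodule.subset_span (Set.mem_range_self i))⟩
  have hφ : Function.Injective φ := fun k l h => by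
    ext i
    have := congrFun (congrArg Subtype.val h) i
    simpa [φ] using this
  refine Summable.of_norm_bounded_eventually (hL.comp_injective hφ) ?_
  filter_upwards [(Set.finite_singleton (0 : Freq)).compl_mem_cofinite] with k hk
  have hk : k ≠ 0 := hk
  rw [Real.norm_of_nonneg (bracket_rpow_pos r k).le, bracket, if_neg hk]
  refine Real.rpow_le_rpow_of_nonpos ?_ ?_ (by linarith)
  · have : φ k ≠ 0 := fun h => hk (hφ (h.trans (by ext i; simp [φ])))
    exact norm_pos_iff.mpr this
  · change ‖(fun i => (k i : ℝ))‖ ≤ _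
    exact (pi_norm_le_iff_of_nonneg (Real.sqrt_nonneg _)).mpr fun i => abs_le_sqrt_normSq k i

/-! ### Fourier coefficients of continuous functions -/

/-- The normalised Haar measure on the torus. -/
abbrev torusMeasure : Measure Torus := Measure.pi fun _ : Fin 3 => AddCircle.haarAddCircle

theorem integrable_of_continuous {u : Torus → ℂ} (hu : Continuous u) :
    Integrable u torusMeasure :=
  hu.integrable_of_hasCompactSupport (HasCompactSupport.of_compactSpace u)

theorem coeff_eq (u : Torus → ℝ) (k : Freq) :
    coeff u k = ∫ x, UnitAddTorus.mFourier (-k) x * (u x : ℂ) ∂torusMeasure := rfl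

theorem continuous_mFourier_mul {u : Torus → ℝ} (hu : Continuous u) (k : Freq) :
    Continuous fun x => UnitAddTorus.mFourier k x * (u x : ℂ) := by fun_prop

theorem coeff_add {u v : Torus → ℝ} (hu : Continuous u) (hv : Continuous v) (k : Freq) :
    coeff (fun x => u x + v x) k = coeff u k + coeff v k := by
  simp only [coeff_eq]
  rw [← integral_add (integrable_of_continuous (continuous_mFourier_mul hu _))
    (integrable_of_continuous (continuous_mFourier_mul hv _))]
  congr 1; ext x; push_cast; ring

theorem coeff_const_mul (c : ℝ) (u : Torus → ℝ) (k : Freq) :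
    coeff (fun x => c * u x) k = c * coeff u k := by
  simp only [coeff_eq]
  rw [← integral_const_mul]
  congr 1; ext x; push_cast; ring

/-- Hermitian symmetry is the trace that real-valuedness leaves on the Fourier side; `reflect` later
encodes it. -/
theorem coeff_neg (u : Torus → ℝ) (k : Freq) :
    coeff u (-k) = starRingEnd ℂ (coeff u k) := by
  simp only [coeff_eq]
  rw [← integral_conj]
  congr 1; ext x
  rw [map_mul, Complex.conj_ofReal, ← UnitAddTorus.mFourier_neg]

/-- The `k`-th Fourier coefficient as a functional on complex continuous functions. -/
def coeffCLM (k : Freq) : C(Torus, ℂ) →L[ℂ] ℂ :=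
  LinearMap.mkContinuous
    { toFun := fun f => UnitAddTorus.mFourierCoeff f k
      map_add' := fun f g => by
        change ∫ x, _ ∂torusMeasure = ∫ x, _ ∂torusMeasure + ∫ x, _ ∂torusMeasure
        rw [← integral_add (integrable_of_continuous (by fun_prop))
          (integrable_of_continuous (by fun_prop))]
        congr 1; ext x; simp [mul_add]
      map_smul' := fun c f => by
        change ∫ x, _ ∂torusMeasure = c * ∫ x, _ ∂torusMeasure
        rw [← integral_const_mul]
        congr 1; ext x; simp; ring } 1 (fun f => by
    change ‖∫ x, UnitAddTorus.mFourier (-k) x * f x ∂torusMeasure‖ ≤ 1 * ‖f‖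
    refine (norm_integral_le_of_norm_le_const (C := ‖f‖) (ae_of_all _ fun x => ?_)).trans ?_
    · rw [norm_mul]
      have h1 := (UnitAddTorus.mFourier (-k)).norm_coe_le_norm x
      rw [UnitAddTorus.mFourier_norm] at h1
      have h2 := f.norm_coe_le_norm x
      nlinarith [norm_nonneg (f x), norm_nonneg (UnitAddTorus.mFourier (-k) x)]
    · simp)

theorem coeffCLM_apply (k : Freq) (f : C(Torus, ℂ)) :
    coeffCLM k f = UnitAddTorus.mFourierCoeff f k := rfl

theorem coeffCLM_mFourier (j k : Freq) :
    coeffCLM k (UnitAddTorus.mFourier j) = if j = k then 1 else 0 := by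
  rw [coeffCLM_apply, ← UnitAddTorus.mFourierCoeff_toLp, ← UnitAddTorus.mFourierBasis_repr]
  change UnitAddTorus.mFourierBasis.repr (UnitAddTorus.mFourierLp 2 j) k = _
  rw [← UnitAddTorus.coe_mFourierBasis, HilbertBasis.repr_self, lp.single_apply, Pi.single_apply]
  simp [eq_comm]

theorem coeff_eq_coeffCLM {u : Torus → ℝ} {f : C(Torus, ℂ)} (h : ∀ x, f x = u x) (k : Freq) :
    coeff u k = coeffCLM k f := by
  rw [coeffCLM_apply, coeff]
  congr 1; ext x; exact (h x).symm

/-- A continuous function with summable Fourier coefficients is the sum of its Fourier series. -/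
theorem hasSum_fourier {u : Torus → ℝ} (hu : Continuous u) (hs : Summable (coeff u)) :
    HasSum (fun k => coeff u k • UnitAddTorus.mFourier k)
      (⟨fun x => (u x : ℂ), by fun_prop⟩ : C(Torus, ℂ)) :=
  UnitAddTorus.hasSum_mFourier_series_of_summable (f := ⟨fun x => (u x : ℂ), by fun_prop⟩) hs

theorem hasSum_fourier_apply {u : Torus → ℝ} (hu : Continuous u) (hs : Summable (coeff u))
    (x : Torus) : HasSum (fun k => coeff u k * UnitAddTorus.mFourier k x) (u x : ℂ) := by
  simpa using! (ContinuousMap.evalCLM ℂ x).hasSum (hasSum_fourier hu hs)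

theorem eq_of_coeff_eq {u v : Torus → ℝ} (hu : Continuous u) (hv : Continuous v)
    (hs : Summable (coeff u)) (h : ∀ k, coeff u k = coeff v k) : u = v := by
  have h' : coeff u = coeff v := funext h
  ext x
  have h1 := hasSum_fourier_apply hu hs x
  rw [h'] at h1
  exact_mod_cast h1.unique (hasSum_fourier_apply hv (h' ▸ hs) x)

theorem norm_mFourier_apply_le (k : Freq) (x : Torus) : ‖UnitAddTorus.mFourier k x‖ ≤ 1 :=
  ((UnitAddTorus.mFourier k).norm_coe_le_norm x).trans_eq UnitAddTorus.mFourier_norm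

/-- Every absolutely summable Hermitian family consists of the Fourier coefficients of a continuous
real function. -/
theorem exists_coeff_eq {c : Freq → ℂ} (hs : Summable fun k => ‖c k‖)
    (hc : ∀ k, c (-k) = starRingEnd ℂ (c k)) :
    ∃ u : Torus → ℝ, Continuous u ∧ (∀ k, coeff u k = c k) ∧
      ∀ x, HasSum (fun k => c k * UnitAddTorus.mFourier k x) (u x : ℂ) := by
  have hsum : Summable fun k => c k • UnitAddTorus.mFourier (d := Fin 3) k :=
    Summable.of_norm (by simpa [norm_smul, UnitAddTorus.mFourier_norm] using hs)
  obtain ⟨f, hf⟩ := hsum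
  have hx (x : Torus) : HasSum (fun k => c k * UnitAddTorus.mFourier k x) (f x) := by
    simpa using! (ContinuousMap.evalCLM ℂ x).hasSum hf
  have hreal (x : Torus) : f x = ((f x).re : ℂ) := by
    have h1 := (hx x).map (starRingEnd ℂ) Complex.continuous_conj
    have h2 := (Equiv.neg Freq).hasSum_iff.mpr h1
    have h3 : ((starRingEnd ℂ) ∘ fun k => c k * UnitAddTorus.mFourier k x) ∘ (Equiv.neg Freq) =
        fun k => c k * UnitAddTorus.mFourier k x := by
      ext k
      simp only [Function.comp, Equiv.neg_apply, map_mul, hc, UnitAddTorus.mFourier_neg,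
        Complex.conj_conj]
    rw [h3] at h2
    exact (Complex.conj_eq_iff_re.mp ((hx x).unique h2).symm).symm
  refine ⟨fun x => (f x).re, by fun_prop, fun k => ?_, fun x => (hreal x) ▸ hx x⟩
  rw [coeff_eq_coeffCLM hreal]
  have h1 := (coeffCLM k).hasSum hf
  refine h1.unique ?_
  have h2 : (fun j => coeffCLM k (c j • UnitAddTorus.mFourier j)) =
      fun j => if j = k then c k else 0 := by
    ext j
    rw [map_smul, coeffCLM_mFourier]
    split_ifs with h <;> simp [h]
  change HasSum (fun j => coeffCLM k (c j • UnitAddTorus.mFourier j)) _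
  rw [h2]
  exact hasSum_ite_eq k (c k)

/-- Fourier coefficients of a product. -/
theorem hasSum_coeff_mul {u v : Torus → ℝ} (hu : Continuous u) (hs : Summable (coeff u))
    (hv : Continuous v) (k : Freq) :
    HasSum (fun j => coeff u j * coeff v (k - j)) (coeff (fun x => u x * v x) k) := by
  let g : C(Torus, ℂ) := ⟨fun x => (v x : ℂ), by fun_prop⟩
  let f : C(Torus, ℂ) := ⟨fun x => (u x : ℂ), by fun_prop⟩
  rw [coeff_eq_coeffCLM (f := f * g) (fun x => by simp [f, g])]
  have h1 := (coeffCLM k).hasSum ((hasSum_fourier hu hs).mul_right g)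
  refine h1.congr_fun fun j => ?_
  simp only [smul_mul_assoc, map_smul, smul_eq_mul]
  congr 1
  rw [coeffCLM_apply]
  change ∫ x, _ ∂torusMeasure = ∫ x, _ ∂torusMeasure
  congr 1; ext x
  have : -(k - j) = -k + j := by ring
  rw [this, UnitAddTorus.mFourier_add]
  simp [g, mul_assoc]

theorem mean_eq {u : Torus → ℝ} : (mean u : ℂ) = coeff u 0 := by
  rw [coeff_eq, mean, ← integral_complex_ofReal]
  congr 1; ext x; simp [UnitAddTorus.mFourier_zero]

theorem coeff_const (c : ℝ) (k : Freq) : coeff (fun _ => c) k = if k = 0 then (c : ℂ) else 0 := by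
  have h := coeff_eq_coeffCLM (u := fun _ => c) (f := (c : ℂ) • UnitAddTorus.mFourier 0)
    (fun x => by simp [UnitAddTorus.mFourier_zero]) k
  rw [h, map_smul, coeffCLM_mFourier]
  simp [eq_comm]

theorem coeff_homPart {u : Torus → ℝ} (hu : Continuous u) (k : Freq) :
    coeff (homPart u) k = if k = 0 then 0 else coeff u k := by
  have : homPart u = fun x => u x + (-mean u) := by ext x; simp [homPart, sub_eq_add_neg]
  rw [this, coeff_add hu continuous_const, coeff_const]
  split_ifs with h
  · subst h; push_cast; rw [mean_eq]; ring
  · simp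

/-! ### Classical derivatives -/

theorem mFourier_add_single (k : Freq) (x : Torus) (j : Fin 3) (h : ℝ) :
    UnitAddTorus.mFourier k (x + Pi.single j ((h / (2 * Real.pi) : ℝ) : UnitAddCircle)) =
      UnitAddTorus.mFourier k x * Complex.exp (Complex.I * k j * h) := by
  have h1 (i : Fin 3) : fourier (k i)
      ((x + Pi.single j ((h / (2 * Real.pi) : ℝ) : UnitAddCircle) : Torus) i) =
      fourier (k i) (x i) * if i = j then Complex.exp (Complex.I * k j * h) else 1 := by
    rw [Pi.add_apply, fourier_apply, fourier_apply, smul_add, AddCircle.toCircle_add,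
      Circle.coe_mul]
    congr 1
    by_cases hij : i = j
    · subst hij
      rw [Pi.single_eq_same, ← fourier_apply, fourier_coe_apply, if_pos rfl]
      congr 1
      have : (Real.pi : ℂ) ≠ 0 := by exact_mod_cast Real.pi_ne_zero
      push_cast
      field_simp
    · rw [Pi.single_eq_of_ne hij, if_neg hij]
      simp
  simp only [UnitAddTorus.mFourier, ContinuousMap.coe_mk, h1, Finset.prod_mul_distrib]
  simp

/-- A shift multiplies each Fourier term by a phase, so the series may be differentiated termwise.
The differentiated terms are dominated, uniformly in the shift, by the summable family in the
hypothesis. -/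
theorem hasDerivAt_shift {u : Torus → ℝ} (hu : Continuous u)
    (hs : Summable fun k => bracket k * ‖coeff u k‖) (j : Fin 3) (x : Torus) {d : ℝ}
    (hd : HasSum (fun k => Complex.I * k j * coeff u k * UnitAddTorus.mFourier k x) (d : ℂ)) :
    HasDerivAt (fun h : ℝ => u (x + Pi.single j ((h / (2 * Real.pi) : ℝ) : UnitAddCircle)))
      d 0 := by
  have hs0 : Summable (coeff u) := Summable.of_norm (hs.of_nonneg_of_le (fun _ => norm_nonneg _)
    fun k => le_mul_of_one_le_left (norm_nonneg _) (one_le_bracket k))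
  let g : Freq → ℝ → ℂ := fun k h =>
    coeff u k * UnitAddTorus.mFourier k x * Complex.exp (Complex.I * k j * h)
  let g' : Freq → ℝ → ℂ := fun k h =>
    coeff u k * UnitAddTorus.mFourier k x *
      (Complex.exp (Complex.I * k j * h) * (Complex.I * k j))
  have hg (k : Freq) (h : ℝ) : HasDerivAt (g k) (g' k h) h := by
    have h1 : HasDerivAt (fun h : ℝ => Complex.I * k j * (h : ℂ)) (Complex.I * k j) h := by
      simpa using (Complex.ofRealCLM.hasDerivAt (x := h)).const_mul (Complex.I * k j)
    exact h1.cexp.const_mul _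
  have hg' (k : Freq) (h : ℝ) : ‖g' k h‖ ≤ bracket k * ‖coeff u k‖ := by
    have h1 : ‖Complex.exp (Complex.I * k j * h)‖ = 1 := by
      rw [show Complex.I * k j * h = ((k j * h : ℝ) : ℂ) * Complex.I by push_cast; ring]
      exact Complex.norm_exp_ofReal_mul_I _
    have h2 : ‖(k j : ℂ)‖ = |(k j : ℝ)| := by
      rw [show (k j : ℂ) = ((k j : ℝ) : ℂ) by push_cast; rfl, Complex.norm_real, Real.norm_eq_abs]
    simp only [g', norm_mul, h1, h2, Complex.norm_I, one_mul]
    calc ‖coeff u k‖ * ‖UnitAddTorus.mFourier k x‖ * |(k j : ℝ)|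
        ≤ ‖coeff u k‖ * 1 * bracket k := by
          gcongr
          · exact norm_mFourier_apply_le k x
          · exact abs_le_bracket k j
      _ = bracket k * ‖coeff u k‖ := by ring
  have hsum (h : ℝ) : HasSum (fun k => g k h)
      (u (x + Pi.single j ((h / (2 * Real.pi) : ℝ) : UnitAddCircle)) : ℂ) := by
    refine (hasSum_fourier_apply hu hs0 _).congr_fun fun k => ?_
    simp only [g]
    rw [mFourier_add_single, mul_assoc]
  have h1 := hasDerivAt_tsum hs hg hg' (hsum 0).summable 0
  have h2 : ∑' k, g' k 0 = (d : ℂ) := by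
    rw [← hd.tsum_eq]
    congr 1; ext k
    simp [g']; ring
  rw [h2] at h1
  have h3 : (fun h => ∑' k, g k h) = fun h : ℝ =>
      (u (x + Pi.single j ((h / (2 * Real.pi) : ℝ) : UnitAddCircle)) : ℂ) :=
    funext fun h => (hsum h).tsum_eq
  rw [h3] at h1
  simpa [Function.comp_def] using Complex.reCLM.hasFDerivAt.comp_hasDerivAt (0 : ℝ) h1

theorem pderiv_spec {u : Torus → ℝ} (hu : Continuous u)
    (hs : Summable fun k => bracket k * ‖coeff u k‖) (j : Fin 3) :
    Continuous (pderiv j u) ∧ ∀ k, coeff (pderiv j u) k = Complex.I * k j * coeff u k := by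
  have hn (k : Freq) : ‖Complex.I * k j * coeff u k‖ ≤ bracket k * ‖coeff u k‖ := by
    have h2 : ‖(k j : ℂ)‖ = |(k j : ℝ)| := by
      rw [show (k j : ℂ) = ((k j : ℝ) : ℂ) by push_cast; rfl, Complex.norm_real, Real.norm_eq_abs]
    rw [norm_mul, norm_mul, Complex.norm_I, one_mul, h2]
    exact mul_le_mul_of_nonneg_right (abs_le_bracket k j) (norm_nonneg _)
  obtain ⟨d, hd, hdc, hds⟩ := exists_coeff_eq (c := fun k => Complex.I * k j * coeff u k)
    (hs.of_nonneg_of_le (fun _ => norm_nonneg _) hn) (fun k => by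
      rw [coeff_neg]; simp)
  have : pderiv j u = d := funext fun x => (hasDerivAt_shift hu hs j x (hds x)).deriv
  rw [this]
  exact ⟨hd, hdc⟩

/-! ### The spaces `H^s` -/

theorem memH_iff {s : ℝ} {u : Torus → ℝ} :
    MemH s u ↔ Continuous u ∧ Summable fun k => ‖(bracket k ^ s : ℝ) * coeff u k‖ ^ 2 := by
  unfold MemH
  simp only [norm_mul, mul_pow, weight_eq, Complex.norm_real, Real.norm_eq_abs, sq_abs]

/-- Sobolev embedding in Fourier form: split the weight as ⟨k⟩^(r-s) times ⟨k⟩^s and apply 2ab ≤ a²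
+ b². The choice r = 0 gives absolutely convergent Fourier series, and r = 1 gives classical
derivatives. -/
theorem MemH.summable_bracket {s r : ℝ} {u : Torus → ℝ} (h : MemH s u) (hr : r + 3 / 2 < s) :
    Summable fun k => bracket k ^ r * ‖coeff u k‖ := by
  have h1 : Summable fun k : Freq => bracket k ^ (2 * (r - s)) :=
    summable_bracket_rpow (by linarith)
  refine ((h1.add h.2).mul_left (1 / 2)).of_nonneg_of_le
    (fun k => mul_nonneg (bracket_rpow_pos r k).le (norm_nonneg _)) fun k => ?_
  have hb := bracket_pos k
  have e1 : bracket k ^ (2 * (r - s)) = (bracket k ^ (r - s)) ^ 2 := by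
    rw [← Real.rpow_natCast, ← Real.rpow_mul hb.le]; congr 1; push_cast; ring
  have e2 : bracket k ^ r = bracket k ^ (r - s) * bracket k ^ s := by
    rw [← Real.rpow_add hb]; congr 1; ring
  rw [weight_eq, e1, e2]
  nlinarith [sq_nonneg (bracket k ^ (r - s) - bracket k ^ s * ‖coeff u k‖)]

theorem MemH.summable_coeff {s : ℝ} {u : Torus → ℝ} (h : MemH s u) (hs : 3 / 2 < s) :
    Summable (coeff u) := by
  refine Summable.of_norm ?_
  simpa using h.summable_bracket (r := 0) (by linarith)

theorem MemH.eq_of_coeff_eq {s s' : ℝ} {u v : Torus → ℝ} (hu : MemH s u) (hs : 3 / 2 < s)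
    (hv : MemH s' v) (h : ∀ k, coeff u k = coeff v k) : u = v :=
  DampedWave.eq_of_coeff_eq hu.1 hv.1 (hu.summable_coeff hs) h

theorem memH_of_norm_coeff_le {s s' C : ℝ} {u v : Torus → ℝ} (hu : MemH s u) (hv : Continuous v)
    (h : ∀ k, bracket k ^ s' * ‖coeff v k‖ ≤ C * (bracket k ^ s * ‖coeff u k‖)) : MemH s' v := by
  refine ⟨hv, (hu.2.mul_left (C ^ 2)).of_nonneg_of_le (fun k => ?_) fun k => ?_⟩
  · rw [weight_eq]; positivity
  · rw [weight_eq, weight_eq]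
    have := pow_le_pow_left₀ (mul_nonneg (bracket_rpow_pos s' k).le (norm_nonneg _)) (h k) 2
    nlinarith

theorem MemH.mono {s s' : ℝ} {u : Torus → ℝ} (h : MemH s u) (hs : s' ≤ s) : MemH s' u :=
  memH_of_norm_coeff_le (C := 1) h h.1 fun k => by
    rw [one_mul]
    exact mul_le_mul_of_nonneg_right (Real.rpow_le_rpow_of_exponent_le (one_le_bracket k) hs)
      (norm_nonneg _)

theorem MemH.const_mul {s : ℝ} {u : Torus → ℝ} (h : MemH s u) (c : ℝ) :
    MemH s fun x => c * u x :=
  memH_of_norm_coeff_le (C := |c|) h (h.1.const_smul c) fun k => by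
    rw [coeff_const_mul, norm_mul, Complex.norm_real, Real.norm_eq_abs]
    exact le_of_eq (by ring)

theorem MemH.add {s : ℝ} {u v : Torus → ℝ} (hu : MemH s u) (hv : MemH s v) :
    MemH s fun x => u x + v x := by
  refine ⟨hu.1.add hv.1, ((hu.2.add hv.2).mul_left 2).of_nonneg_of_le (fun k => ?_) fun k => ?_⟩
  · rw [weight_eq]; positivity
  · rw [coeff_add hu.1 hv.1, weight_eq, ← mul_add, mul_left_comm]
    gcongr
    have := pow_le_pow_left₀ (norm_nonneg _) (norm_add_le (coeff u k) (coeff v k)) 2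
    nlinarith [sq_nonneg (‖coeff u k‖ - ‖coeff v k‖)]

theorem MemH.sub {s : ℝ} {u v : Torus → ℝ} (hu : MemH s u) (hv : MemH s v) :
    MemH s fun x => u x - v x := by
  simpa [sub_eq_add_neg] using hu.add (hv.const_mul (-1))

theorem memH_const (s c : ℝ) : MemH s fun _ => c := by
  refine ⟨continuous_const, summable_of_ne_finset_zero (s := {0}) fun k hk => ?_⟩
  rw [coeff_const, if_neg (by simpa using hk)]
  simp

theorem MemH.homPart {s : ℝ} {u : Torus → ℝ} (hu : MemH s u) : MemH s (homPart u) :=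
  hu.sub (memH_const s _)

theorem MemH.coeff_pderiv {s : ℝ} {u : Torus → ℝ} (hu : MemH s u) (hs : 5 / 2 < s) (j : Fin 3)
    (k : Freq) : coeff (pderiv j u) k = Complex.I * k j * coeff u k :=
  (pderiv_spec hu.1 (by simpa using hu.summable_bracket (r := 1) (by linarith)) j).2 k

theorem MemH.pderiv {s : ℝ} {u : Torus → ℝ} (hu : MemH s u) (hs : 5 / 2 < s) (j : Fin 3) :
    MemH (s - 1) (pderiv j u) := by
  refine memH_of_norm_coeff_le (C := 1) hu
    (pderiv_spec hu.1 (by simpa using hu.summable_bracket (r := 1) (by linarith)) j).1 fun k => ?_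
  have h2 : ‖(k j : ℂ)‖ = |(k j : ℝ)| := by
    rw [show (k j : ℂ) = ((k j : ℝ) : ℂ) by push_cast; rfl, Complex.norm_real, Real.norm_eq_abs]
  rw [hu.coeff_pderiv hs, norm_mul, norm_mul, Complex.norm_I, h2, one_mul, one_mul, ← mul_assoc]
  gcongr
  have hb := bracket_pos k
  calc bracket k ^ (s - 1) * |(k j : ℝ)| ≤ bracket k ^ (s - 1) * bracket k := by
        gcongr; exact abs_le_bracket k j
    _ = bracket k ^ s := by
        rw [Real.rpow_sub_one hb.ne']; field_simp

/-- Two classical derivatives require s > 7/2; with s = m + 1 this is the condition m > 5/2. -/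
theorem MemH.laplacian_spec {s : ℝ} {u : Torus → ℝ} (hu : MemH s u) (hs : 7 / 2 < s) :
    MemH (s - 2) (laplacian u) ∧ ∀ k, coeff (laplacian u) k = -(normSq k : ℂ) * coeff u k := by
  have h1 (j : Fin 3) := hu.pderiv (by linarith) j
  have h2 (j : Fin 3) := (h1 j).pderiv (by linarith) j
  have e : laplacian u = fun x => DampedWave.pderiv 0 (DampedWave.pderiv 0 u) x
      + DampedWave.pderiv 1 (DampedWave.pderiv 1 u) x
      + DampedWave.pderiv 2 (DampedWave.pderiv 2 u) x := by
    ext x; simp [laplacian, Fin.sum_univ_three]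
  have e2 : s - 1 - 1 = s - 2 := by ring
  rw [e]
  refine ⟨e2 ▸ ((h2 0).add (h2 1)).add (h2 2), fun k => ?_⟩
  rw [coeff_add ((h2 0).add (h2 1)).1 (h2 2).1, coeff_add (h2 0).1 (h2 1).1]
  rw [(h1 0).coeff_pderiv (by linarith), (h1 1).coeff_pderiv (by linarith),
    (h1 2).coeff_pderiv (by linarith), hu.coeff_pderiv (by linarith),
    hu.coeff_pderiv (by linarith), hu.coeff_pderiv (by linarith), normSq, Fin.sum_univ_three]
  push_cast
  ring_nf
  simp only [Complex.I_sq]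
  ring

/-- Pointwise form and Fourier form of the equation at a fixed time. -/
theorem equation_iff {s κ c : ℝ} {u ut utt F : Torus → ℝ} (hs : 5 / 2 < s) (hu : MemH (s + 1) u)
    (hut : MemH s ut) (hutt : MemH (s - 1) utt) (hF : MemH s F) :
    (mean utt + 2 * κ * mean ut = c * mean F ∧
      ∀ x, homPart utt x + 2 * κ * homPart ut x - laplacian (homPart u) x =
        c * (F x - mean F)) ↔
    ∀ k, coeff utt k + 2 * κ * coeff ut k + normSq k * coeff u k = c * coeff F k := by
  have hmean : (mean utt + 2 * κ * mean ut = c * mean F) ↔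
      coeff utt 0 + 2 * κ * coeff ut 0 = c * coeff F 0 := by
    rw [← mean_eq, ← mean_eq, ← mean_eq]
    exact_mod_cast Iff.rfl
  obtain ⟨hL, hLc⟩ := hu.homPart.laplacian_spec (by linarith)
  have hL' : MemH (s - 1) (laplacian (homPart u)) := by
    convert hL using 1; ring
  have hl : MemH (s - 1) fun x => homPart utt x + 2 * κ * homPart ut x
      + (-1) * laplacian (homPart u) x :=
    (hutt.homPart.add ((hut.homPart.mono (by linarith)).const_mul _)).add (hL'.const_mul _)
  have hr : MemH s fun x => c * homPart F x := hF.homPart.const_mul c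
  have hlc (k : Freq) : coeff (fun x => homPart utt x + 2 * κ * homPart ut x
      + (-1) * laplacian (homPart u) x) k =
      if k = 0 then 0 else coeff utt k + 2 * κ * coeff ut k + normSq k * coeff u k := by
    rw [coeff_add (u := fun x => homPart utt x + 2 * κ * homPart ut x)
      (hutt.homPart.add ((hut.homPart.mono (by linarith)).const_mul _)).1
      (hL'.const_mul _).1, coeff_add hutt.homPart.1 (hut.homPart.const_mul _).1,
      coeff_const_mul, coeff_const_mul, hLc, coeff_homPart hu.1, coeff_homPart hut.1,
      coeff_homPart hutt.1]
    split_ifs <;> push_cast <;> ring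
  have hrc (k : Freq) : coeff (fun x => c * homPart F x) k =
      if k = 0 then 0 else c * coeff F k := by
    rw [coeff_const_mul, coeff_homPart hF.1]; split_ifs <;> simp
  have hfun : (∀ x, homPart utt x + 2 * κ * homPart ut x - laplacian (homPart u) x =
        c * (F x - mean F)) ↔ (fun x => homPart utt x + 2 * κ * homPart ut x
      + (-1) * laplacian (homPart u) x) = fun x => c * homPart F x := by
    rw [funext_iff]
    refine forall_congr' fun x => ?_
    rw [neg_one_mul, ← sub_eq_add_neg]
    rfl
  rw [hmean, hfun]
  constructor
  · rintro ⟨h0, h1⟩ k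
    by_cases hk : k = 0
    · subst hk; rw [normSq_zero]; simpa using h0
    · have := congrArg (fun w => coeff w k) h1
      simp only [hlc, hrc, if_neg hk] at this
      exact this
  -- The frequency k = 0 gives the mean equation. The remaining frequencies determine the mean-free
  -- equation, since both of its sides have vanishing zero mode.
  · intro h
    refine ⟨by simpa [normSq_zero] using h 0, hl.eq_of_coeff_eq (by linarith) hr fun k => ?_⟩
    rw [hlc, hrc]
    split_ifs with hk
    · rfl
    · exact h k

/-! ### The space of square summable sequences -/

/-- The real Hilbert space of square summable complex families indexed by the frequencies. -/
def Seq : Type := lp (fun _ : Freq => ℂ) 2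

namespace Seq

instance : NormedAddCommGroup Seq := inferInstanceAs (NormedAddCommGroup (lp (fun _ : Freq => ℂ) 2))

instance : InnerProductSpace ℝ Seq :=
  inferInstanceAs (InnerProductSpace ℝ (lp (fun _ : Freq => ℂ) 2))

instance : CompleteSpace Seq := inferInstanceAs (CompleteSpace (lp (fun _ : Freq => ℂ) 2))

instance : CoeFun Seq fun _ => Freq → ℂ := ⟨fun x => Subtype.val (α := Freq → ℂ) x⟩

theorem ext {x y : Seq} (h : ∀ k, x k = y k) : x = y := Subtype.ext (funext h)

theorem add_apply (x y : Seq) (k : Freq) : (x + y) k = x k + y k := rfl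

theorem sub_apply (x y : Seq) (k : Freq) : (x - y) k = x k - y k := rfl

theorem zero_apply (k : Freq) : (0 : Seq) k = 0 := rfl

theorem smul_apply (c : ℝ) (x : Seq) (k : Freq) : (c • x) k = c * x k :=
  Complex.real_smul (x := c) (z := x k)

/-- The element of `Seq` with given entries. -/
def mk (f : Freq → ℂ) (hf : Summable fun k => ‖f k‖ ^ 2) : Seq :=
  ⟨f, memℓp_gen (by simpa using! hf)⟩

theorem mk_apply (f : Freq → ℂ) (hf : Summable fun k => ‖f k‖ ^ 2) (k : Freq) : mk f hf k = f k :=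
  rfl

theorem hasSum_norm_sq (x : Seq) : HasSum (fun k => ‖x k‖ ^ 2) (‖x‖ ^ 2) := by
  have := lp.hasSum_norm (p := 2) (by simp) (show lp (fun _ : Freq => ℂ) 2 from x)
  simpa using! this

theorem norm_sq (x : Seq) : ‖x‖ ^ 2 = ∑' k, ‖x k‖ ^ 2 := (hasSum_norm_sq x).tsum_eq.symm

theorem norm_apply_le (x : Seq) (k : Freq) : ‖x k‖ ≤ ‖x‖ := by
  refine (pow_le_pow_iff_left₀ (norm_nonneg _) (norm_nonneg _) two_ne_zero).mp ?_
  exact le_hasSum (hasSum_norm_sq x) k fun _ _ => sq_nonneg _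

theorem norm_le_of_sq_le {x : Seq} {a : Freq → ℝ} {C A : ℝ} (hC : 0 ≤ C) (ha : HasSum a A)
    (h : ∀ k, ‖x k‖ ^ 2 ≤ a k) (hA : A ≤ C ^ 2) : ‖x‖ ≤ C :=
  (pow_le_pow_iff_left₀ (norm_nonneg _) hC two_ne_zero).mp
    ((hasSum_le h (hasSum_norm_sq x) ha).trans hA)

theorem norm_le_norm {x y : Seq} (h : ∀ k, ‖x k‖ ≤ ‖y k‖) : ‖x‖ ≤ ‖y‖ :=
  norm_le_of_sq_le (norm_nonneg _) (hasSum_norm_sq y)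
    (fun k => pow_le_pow_left₀ (norm_nonneg _) (h k) 2) le_rfl

/-- Evaluation at a frequency. -/
def evalCLM (k : Freq) : Seq →L[ℝ] ℂ :=
  LinearMap.mkContinuous
    { toFun := fun x => x k
      map_add' := fun _ _ => rfl
      map_smul' := fun c x => smul_apply c x k } 1 fun x => by
        rw [one_mul]; exact norm_apply_le x k

end Seq

open DampedWave.Seq

/-- The Fourier multiplier with symbol `d`. -/
def diag (d : Freq → ℂ) (hd : ∀ k, ‖d k‖ ≤ 1) : Seq →L[ℝ] Seq :=
  LinearMap.mkContinuous
    { toFun := fun x => Seq.mk (fun k => d k * x k)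
        ((hasSum_norm_sq x).summable.of_nonneg_of_le (fun _ => sq_nonneg _) fun k => by
          rw [norm_mul]
          exact pow_le_pow_left₀ (by positivity)
            (mul_le_of_le_one_left (norm_nonneg _) (hd k)) 2)
      map_add' := fun x y => Seq.ext fun k => mul_add _ _ _
      map_smul' := fun c x => Seq.ext fun k => by
        simp only [Seq.smul_apply, mk_apply, RingHom.id_apply]; ring } 1 fun x => by
        rw [one_mul]
        refine norm_le_norm fun k => ?_
        change ‖d k * x k‖ ≤ _
        rw [norm_mul]
        exact mul_le_of_le_one_left (norm_nonneg _) (hd k)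

theorem diag_apply (d : Freq → ℂ) (hd : ∀ k, ‖d k‖ ≤ 1) (x : Seq) (k : Freq) :
    diag d hd x k = d k * x k := rfl

theorem norm_diag_le (d : Freq → ℂ) (hd : ∀ k, ‖d k‖ ≤ 1) (x : Seq) : ‖diag d hd x‖ ≤ ‖x‖ :=
  norm_le_norm fun k => by
    rw [diag_apply, norm_mul]
    exact mul_le_of_le_one_left (norm_nonneg _) (hd k)

attribute [irreducible] diag

/-- The reflection `x ↦ conj x(-·)`, whose fixed points correspond to real functions. -/
def reflect : Seq →L[ℝ] Seq :=
  LinearMap.mkContinuous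
    { toFun := fun x => Seq.mk (fun k => starRingEnd ℂ (x (-k))) (by
        simpa using! (Equiv.neg Freq).summable_iff.mpr (hasSum_norm_sq x).summable)
      map_add' := fun x y => Seq.ext fun k => map_add _ _ _
      map_smul' := fun c x => Seq.ext fun k => by
        simp only [Seq.smul_apply, mk_apply, RingHom.id_apply, map_mul, Complex.conj_ofReal] } 1
    fun x => by
      rw [one_mul]
      refine norm_le_of_sq_le (norm_nonneg _)
        ((Equiv.neg Freq).hasSum_iff.mpr (hasSum_norm_sq x)) (fun k => ?_) le_rfl
      exact le_of_eq (congrArg (· ^ 2) (RCLike.norm_conj _))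

theorem reflect_apply (x : Seq) (k : Freq) : reflect x k = starRingEnd ℂ (x (-k)) := rfl

theorem norm_reflect_le (x : Seq) : ‖reflect x‖ ≤ ‖x‖ := by
  refine norm_le_of_sq_le (norm_nonneg _)
    ((Equiv.neg Freq).hasSum_iff.mpr (hasSum_norm_sq x)) (fun k => ?_) le_rfl
  exact le_of_eq (congrArg (· ^ 2) (RCLike.norm_conj _))

attribute [irreducible] reflect

/-- The Fourier multiplier `1 / max 1 |k|`. -/
def lam : Seq →L[ℝ] Seq := diag (fun k => ((bracket k)⁻¹ : ℝ)) fun k => by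
  rw [Complex.norm_real, Real.norm_of_nonneg (inv_nonneg.mpr (bracket_pos k).le)]
  exact inv_le_one_of_one_le₀ (one_le_bracket k)

theorem lam_apply (x : Seq) (k : Freq) : lam x k = ((bracket k)⁻¹ : ℝ) * x k := diag_apply _ _ _ _

/-- The Fourier multiplier `|k|² / (max 1 |k|)²`. -/
def lapDiag : Seq →L[ℝ] Seq := diag (fun k => (normSq k / bracket k ^ 2 : ℝ)) fun k => by
  rw [Complex.norm_real, Real.norm_of_nonneg (div_nonneg (normSq_nonneg k) (sq_nonneg _))]
  exact div_le_one_of_le₀ (normSq_le_bracket_sq k) (sq_nonneg _)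

theorem lapDiag_apply (x : Seq) (k : Freq) :
    lapDiag x k = (normSq k / bracket k ^ 2 : ℝ) * x k := diag_apply _ _ _ _

/-- The projection onto the zero mode. -/
def zeroProj : Seq →L[ℝ] Seq := diag (fun k => if k = 0 then 1 else 0) fun k => by
  split_ifs <;> simp

theorem zeroProj_apply (x : Seq) (k : Freq) : zeroProj x k = (if k = 0 then 1 else 0) * x k := diag_apply _ _ _ _

/-- The projection onto the nonzero modes. -/
def offProj : Seq →L[ℝ] Seq := diag (fun k => if k = 0 then 0 else 1) fun k => by
  split_ifs <;> simp

theorem offProj_apply (x : Seq) (k : Freq) : offProj x k = (if k = 0 then 0 else 1) * x k := diag_apply _ _ _ _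

/-- Multiplication by the imaginary unit. -/
def mulI : Seq →L[ℝ] Seq := diag (fun _ => Complex.I) fun _ => by simp

theorem mulI_apply (x : Seq) (k : Freq) : mulI x k = Complex.I * x k := diag_apply _ _ _ _

theorem norm_exp_I_mul (t : ℝ) (k : Freq) : ‖Complex.exp (Complex.I * (t * bracket k : ℝ))‖ = 1 := by
  rw [mul_comm]; exact Complex.norm_exp_ofReal_mul_I _

/-- The unitary group with symbol `exp (i t max 1 |k|)`. -/
def evol (t : ℝ) : Seq →L[ℝ] Seq := diag (fun k => Complex.exp (Complex.I * (t * bracket k : ℝ)))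
  fun k => (norm_exp_I_mul t k).le

theorem evol_apply (t : ℝ) (x : Seq) (k : Freq) :
    evol t x k = Complex.exp (Complex.I * (t * bracket k : ℝ)) * x k := diag_apply _ _ _ _

theorem evol_evol_neg (t : ℝ) (x : Seq) : evol t (evol (-t) x) = x := Seq.ext fun k => by
  rw [evol_apply, evol_apply, ← mul_assoc, ← Complex.exp_add]
  simp

theorem evol_neg_evol (t : ℝ) (x : Seq) : evol (-t) (evol t x) = x := by
  simpa using evol_evol_neg (-t) x

theorem norm_evol (t : ℝ) (x : Seq) : ‖evol t x‖ = ‖x‖ := by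
  refine le_antisymm (norm_diag_le _ _ x) ?_
  conv_lhs => rw [← evol_neg_evol t x]
  exact norm_diag_le _ _ _

/-- The symbol oscillates arbitrarily fast at high frequency, so only strong continuity is claimed.
It follows by dominated convergence over the frequencies, each term of the squared difference being
at most 4‖x k‖². -/
theorem continuous_evol_apply (x : Seq) : Continuous fun t => evol t x := by
  rw [continuous_iff_continuousAt]
  intro t₀
  rw [ContinuousAt, tendsto_iff_norm_sub_tendsto_zero]
  have h1 : Tendsto (fun t => ∑' k, ‖(evol t x - evol t₀ x) k‖ ^ 2) (𝓝 t₀)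
      (𝓝 (∑' _ : Freq, (0 : ℝ))) := by
    refine tendsto_tsum_of_dominated_convergence (bound := fun k => 4 * ‖x k‖ ^ 2)
      ((hasSum_norm_sq x).summable.mul_left 4) (fun k => ?_) (Eventually.of_forall fun t k => ?_)
    · have : Continuous fun t => ‖(evol t x - evol t₀ x) k‖ ^ 2 := by
        simp only [Seq.sub_apply, evol_apply]
        fun_prop
      have h := this.tendsto t₀
      simpa [Seq.zero_apply] using! h
    · rw [Real.norm_of_nonneg (sq_nonneg _), Seq.sub_apply, evol_apply, evol_apply]
      have := norm_sub_le (Complex.exp (Complex.I * (t * bracket k : ℝ)) * x k)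
        (Complex.exp (Complex.I * (t₀ * bracket k : ℝ)) * x k)
      rw [norm_mul, norm_mul, norm_exp_I_mul, norm_exp_I_mul] at this
      have h2 := pow_le_pow_left₀ (norm_nonneg _) this 2
      refine h2.trans (le_of_eq (by ring))
  simp only [← Seq.norm_sq, tsum_zero] at h1
  simpa [Function.comp_def, Real.sqrt_sq (norm_nonneg _)] using
    (Real.continuous_sqrt.tendsto 0).comp h1

theorem continuous_evol : Continuous fun p : ℝ × Seq => evol p.1 p.2 :=
  continuous_prod_of_continuous_lipschitzWith' _ 1
    (fun t => LipschitzWith.of_dist_le_mul fun x y => by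
      rw [dist_eq_norm, dist_eq_norm, ← map_sub, norm_evol]; simp) continuous_evol_apply

/-- A curve in `Seq` whose entries are differentiable, with a continuous curve of derivatives, is
differentiable. -/
theorem hasDerivWithinAt_of_apply {y v : ℝ → Seq} {b : ℝ} (hb : 0 ≤ b)
    (hv : ContinuousOn v (Set.Icc 0 b))
    (h : ∀ k, ∀ t ∈ Set.Icc 0 b, HasDerivWithinAt (fun t => y t k) (v t k) (Set.Icc 0 b) t) :
    ∀ t ∈ Set.Icc 0 b, HasDerivWithinAt y (v t) (Set.Icc 0 b) t := by
  let v' : ℝ → Seq := Set.IccExtend hb ((Set.Icc 0 b).domRestrict v)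
  have hv' : Continuous v' := Continuous.Icc_extend' (continuousOn_iff_continuous_domRestrict.mp hv)
  have hvv {t : ℝ} (ht : t ∈ Set.Icc 0 b) : v' t = v t := Set.IccExtend_of_mem hb _ ht
  let z : ℝ → Seq := fun t => y 0 + ∫ τ in (0 : ℝ)..t, v' τ
  have hz (t : ℝ) : HasDerivAt z (v' t) t :=
    (intervalIntegral.integral_hasDerivAt_right (hv'.intervalIntegrable _ _)
      (hv'.stronglyMeasurableAtFilter _ _) hv'.continuousAt).const_add _
  have hzy : Set.EqOn y z (Set.Icc 0 b) := by
    intro t ht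
    refine Seq.ext fun k => ?_
    have hd : ∀ τ ∈ Set.Icc 0 b, HasDerivWithinAt (fun τ => y τ k - z τ k) 0 (Set.Icc 0 b) τ := by
      intro τ hτ
      have h1 := ((evalCLM k).hasFDerivAt.comp_hasDerivAt τ (hz τ)).hasDerivWithinAt
        (s := Set.Icc 0 b)
      rw [hvv hτ] at h1
      have h2 := (h k τ hτ).sub h1
      have e : v τ k - evalCLM k (v τ) = 0 := sub_self _
      rw [e] at h2
      exact h2
    have h0 := constant_of_has_deriv_right_zero (fun τ hτ => (hd τ hτ).continuousWithinAt)
      (fun τ hτ => (hd τ (Set.Ico_subset_Icc_self hτ)).mono_of_mem_nhdsWithin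
        (Icc_mem_nhdsGE_of_mem hτ)) t ht
    have hz0 : z 0 = y 0 := by simp [z]
    rw [hz0, sub_self] at h0
    exact sub_eq_zero.mp h0
  intro t ht
  exact ((hvv ht) ▸ (hz t).hasDerivWithinAt).congr_of_mem hzy ht

/-! ### The product on the sequence side -/

/-- The terms of the convolution that represents the product in `H^s`. -/
def convTerm (s : ℝ) (x y : Seq) (k j : Freq) : ℂ :=
  ((bracket j ^ (-s) : ℝ) * x j) * ((bracket (k - j) ^ (-s) : ℝ) * y (k - j))

/-- Operator bound for the product in `H^s`, squared. -/
def convConst (s : ℝ) : ℝ := 2 * 2 ^ (2 * s) * ∑' k : Freq, bracket k ^ (-(2 * s))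

theorem convConst_nonneg (s : ℝ) : 0 ≤ convConst s :=
  mul_nonneg (by positivity) (tsum_nonneg fun k => (bracket_rpow_pos _ k).le)

/-- The shear (k, j) ↦ (j, k - j) is a bijection of pairs of frequencies, so summing along its
fibres rearranges the product of the two norm series. -/
theorem hasSum_mul_norm_sq (x y : Seq) :
    (∀ k, Summable fun j => (‖x j‖ * ‖y (k - j)‖) ^ 2) ∧
    HasSum (fun k => ∑' j, (‖x j‖ * ‖y (k - j)‖) ^ 2) (‖x‖ ^ 2 * ‖y‖ ^ 2) := by
  let e : Freq × Freq ≃ Freq × Freq :=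
    { toFun := fun p => (p.2, p.1 - p.2)
      invFun := fun p => (p.1 + p.2, p.1)
      left_inv := fun p => by simp
      right_inv := fun p => by simp }
  have h1 : HasSum (fun p : Freq × Freq => ‖x p.1‖ ^ 2 * ‖y p.2‖ ^ 2) (‖x‖ ^ 2 * ‖y‖ ^ 2) :=
    (hasSum_norm_sq x).mul (hasSum_norm_sq y) ((hasSum_norm_sq x).summable.mul_of_nonneg
      (hasSum_norm_sq y).summable (fun _ => sq_nonneg _) (fun _ => sq_nonneg _))
  have h2 := e.hasSum_iff.mpr h1
  have h3 : (fun p : Freq × Freq => ‖x p.1‖ ^ 2 * ‖y p.2‖ ^ 2) ∘ e =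
      fun p => (‖x p.2‖ * ‖y (p.1 - p.2)‖) ^ 2 := by
    ext p; simp [e, mul_pow]
  rw [h3] at h2
  have h4 := fun k => h2.summable.prod_factor k
  exact ⟨h4, h2.prod_fiberwise fun k => (h4 k).hasSum⟩

/-- Since k = j + (k - j), the weight ⟨k⟩^(2s) is controlled by ⟨j⟩^(2s) + ⟨k-j⟩^(2s). Each summand
cancels one of the two negative weights, and the other is summable because 2s > 3. The bound is
uniform in k. -/
theorem summable_bracket_conv {s : ℝ} (hs : 3 / 2 < s) (k : Freq) :
    (Summable fun j => (bracket j ^ (-s) * bracket (k - j) ^ (-s)) ^ 2) ∧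
    (bracket k ^ s) ^ 2 * ∑' j, (bracket j ^ (-s) * bracket (k - j) ^ (-s)) ^ 2 ≤
      convConst s := by
  have hsum : Summable fun k : Freq => bracket k ^ (-(2 * s)) :=
    summable_bracket_rpow (by linarith)
  have hsum' : Summable fun j : Freq => bracket (k - j) ^ (-(2 * s)) :=
    (Equiv.subLeft k).summable_iff.mpr hsum
  have hterm (j : Freq) : (bracket k ^ s) ^ 2 * (bracket j ^ (-s) * bracket (k - j) ^ (-s)) ^ 2 ≤
      2 ^ (2 * s) * (bracket (k - j) ^ (-(2 * s)) + bracket j ^ (-(2 * s))) := by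
    have hsq (r : ℝ) (l : Freq) : (bracket l ^ r) ^ 2 = bracket l ^ (2 * r) := by
      rw [← Real.rpow_natCast, ← Real.rpow_mul (bracket_pos l).le]; congr 1; push_cast; ring
    have hb := bracket_rpow_add_le (s := 2 * s) (by linarith) j (k - j)
    rw [add_sub_cancel] at hb
    rw [mul_pow, hsq, hsq, hsq, show 2 * -s = -(2 * s) by ring]
    have p1 := bracket_rpow_pos (-(2 * s)) j
    have p2 := bracket_rpow_pos (-(2 * s)) (k - j)
    have e1 : bracket j ^ (2 * s) * bracket j ^ (-(2 * s)) = 1 := by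
      rw [← Real.rpow_add (bracket_pos j)]; simp
    have e2 : bracket (k - j) ^ (2 * s) * bracket (k - j) ^ (-(2 * s)) = 1 := by
      rw [← Real.rpow_add (bracket_pos _)]; simp
    calc bracket k ^ (2 * s) * (bracket j ^ (-(2 * s)) * bracket (k - j) ^ (-(2 * s)))
        ≤ 2 ^ (2 * s) * (bracket j ^ (2 * s) + bracket (k - j) ^ (2 * s)) *
          (bracket j ^ (-(2 * s)) * bracket (k - j) ^ (-(2 * s))) := by gcongr
      _ = 2 ^ (2 * s) * ((bracket j ^ (2 * s) * bracket j ^ (-(2 * s))) *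
            bracket (k - j) ^ (-(2 * s)) +
          (bracket (k - j) ^ (2 * s) * bracket (k - j) ^ (-(2 * s))) *
            bracket j ^ (-(2 * s))) := by ring
      _ = _ := by rw [e1, e2]; ring
  have hS := (hsum'.add hsum).mul_left (2 ^ (2 * s))
  have hpos : 0 < (bracket k ^ s) ^ 2 := pow_pos (bracket_rpow_pos s k) 2
  have hA : Summable fun j =>
      (bracket k ^ s) ^ 2 * (bracket j ^ (-s) * bracket (k - j) ^ (-s)) ^ 2 :=
    hS.of_nonneg_of_le (fun j => by positivity) hterm
  refine ⟨(summable_mul_left_iff hpos.ne').mp hA, ?_⟩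
  rw [← tsum_mul_left]
  refine (hA.tsum_le_tsum hterm hS).trans (le_of_eq ?_)
  rw [tsum_mul_left, hsum'.tsum_add hsum, convConst]
  have : ∑' j : Freq, bracket (k - j) ^ (-(2 * s)) = ∑' j : Freq, bracket j ^ (-(2 * s)) :=
    (Equiv.subLeft k).tsum_eq fun j => bracket j ^ (-(2 * s))
  rw [this]; ring

/-- Cauchy–Schwarz separates the weights from the entries. The weights give `convConst`, and the
remaining factor sums over k to ‖x‖²‖y‖², which makes H^s an algebra. -/
theorem convTerm_bound {s : ℝ} (hs : 3 / 2 < s) (x y : Seq) (k : Freq) :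
    Summable (convTerm s x y k) ∧
    ‖((bracket k ^ s : ℝ) : ℂ) * ∑' j, convTerm s x y k j‖ ^ 2 ≤
      convConst s * ∑' j, (‖x j‖ * ‖y (k - j)‖) ^ 2 := by
  obtain ⟨h1, h2⟩ := summable_bracket_conv hs k
  have h3 := (hasSum_mul_norm_sq x y).1 k
  have hn (j : Freq) : ‖convTerm s x y k j‖ =
      (bracket j ^ (-s) * bracket (k - j) ^ (-s)) * (‖x j‖ * ‖y (k - j)‖) := by
    simp only [convTerm, norm_mul, Complex.norm_real,
      Real.norm_of_nonneg (bracket_rpow_pos (-s) j).le,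
      Real.norm_of_nonneg (bracket_rpow_pos (-s) (k - j)).le]
    ring
  have hp (j : Freq) : 0 ≤ bracket j ^ (-s) * bracket (k - j) ^ (-s) :=
    mul_nonneg (bracket_rpow_pos _ _).le (bracket_rpow_pos _ _).le
  have hq (j : Freq) : 0 ≤ ‖x j‖ * ‖y (k - j)‖ := by positivity
  have h4 := Real.inner_le_Lp_mul_Lq_tsum_of_nonneg Real.HolderConjugate.two_two hp hq
    (by simpa using h1) (by simpa using h3)
  have h5 : Summable fun j => ‖convTerm s x y k j‖ := by
    simpa only [hn] using Real.summable_mul_of_Lp_Lq_of_nonneg Real.HolderConjugate.two_two hp hq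
      (by simpa using h1) (by simpa using h3)
  refine ⟨h5.of_norm, ?_⟩
  have h6 : ‖∑' j, convTerm s x y k j‖ ≤ Real.sqrt (∑' j,
      (bracket j ^ (-s) * bracket (k - j) ^ (-s)) ^ 2) *
      Real.sqrt (∑' j, (‖x j‖ * ‖y (k - j)‖) ^ 2) := by
    refine (norm_tsum_le_tsum_norm h5).trans ?_
    simp only [hn, Real.sqrt_eq_rpow]
    simpa using h4
  have h7 := pow_le_pow_left₀ (norm_nonneg _) h6 2
  rw [mul_pow, Real.sq_sqrt (tsum_nonneg fun _ => sq_nonneg _),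
    Real.sq_sqrt (tsum_nonneg fun _ => sq_nonneg _)] at h7
  rw [norm_mul, mul_pow, Complex.norm_real, Real.norm_of_nonneg (bracket_rpow_pos s k).le]
  calc (bracket k ^ s) ^ 2 * ‖∑' j, convTerm s x y k j‖ ^ 2
      ≤ (bracket k ^ s) ^ 2 * ((∑' j, (bracket j ^ (-s) * bracket (k - j) ^ (-s)) ^ 2) *
        ∑' j, (‖x j‖ * ‖y (k - j)‖) ^ 2) := by gcongr
    _ = ((bracket k ^ s) ^ 2 * ∑' j, (bracket j ^ (-s) * bracket (k - j) ^ (-s)) ^ 2) *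
        ∑' j, (‖x j‖ * ‖y (k - j)‖) ^ 2 := by ring
    _ ≤ _ := by
        gcongr

/-- The bilinear map on `Seq` that represents the product in `H^s`, `s > 3/2`. -/
def conv (s : ℝ) (hs : 3 / 2 < s) : Seq →L[ℝ] Seq →L[ℝ] Seq :=
  LinearMap.mkContinuous₂
    (LinearMap.mk₂ ℝ
      (fun x y => Seq.mk (fun k => ((bracket k ^ s : ℝ) : ℂ) * ∑' j, convTerm s x y k j)
        (((hasSum_mul_norm_sq x y).2.summable.mul_left (convConst s)).of_nonneg_of_le
          (fun _ => sq_nonneg _) fun k => (convTerm_bound hs x y k).2))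
      (fun x x' y => Seq.ext fun k => by
        have h : convTerm s (x + x') y k = fun j => convTerm s x y k j + convTerm s x' y k j := by
          funext j; simp only [convTerm, Seq.add_apply]; ring
        simp only [Seq.add_apply, mk_apply]
        rw [h, (convTerm_bound hs x y k).1.tsum_add (convTerm_bound hs x' y k).1, mul_add])
      (fun c x y => Seq.ext fun k => by
        have h : convTerm s (c • x) y k = fun j => c * convTerm s x y k j := by
          funext j; simp only [convTerm, Seq.smul_apply]; ring
        simp only [Seq.smul_apply, mk_apply]
        rw [h, tsum_mul_left, mul_left_comm])
      (fun x y y' => Seq.ext fun k => by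
        have h : convTerm s x (y + y') k = fun j => convTerm s x y k j + convTerm s x y' k j := by
          funext j; simp only [convTerm, Seq.add_apply]; ring
        simp only [Seq.add_apply, mk_apply]
        rw [h, (convTerm_bound hs x y k).1.tsum_add (convTerm_bound hs x y' k).1, mul_add])
      (fun c x y => Seq.ext fun k => by
        have h : convTerm s x (c • y) k = fun j => c * convTerm s x y k j := by
          funext j; simp only [convTerm, Seq.smul_apply]; ring
        simp only [Seq.smul_apply, mk_apply]
        rw [h, tsum_mul_left, mul_left_comm]))
    (Real.sqrt (convConst s)) fun x y => by
      refine norm_le_of_sq_le (by positivity)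
        ((hasSum_mul_norm_sq x y).2.mul_left (convConst s))
        (fun k => (convTerm_bound hs x y k).2) (le_of_eq ?_)
      rw [mul_pow, mul_pow, Real.sq_sqrt (convConst_nonneg s)]; ring

theorem conv_apply (s : ℝ) (hs : 3 / 2 < s) (x y : Seq) (k : Freq) :
    conv s hs x y k = ((bracket k ^ s : ℝ) : ℂ) * ∑' j, convTerm s x y k j := rfl

attribute [irreducible] conv

/-! ### The isometry between `H^s` and sequences -/

open Classical in
/-- The family `(max 1 |k|)^s û_k`. -/
def enc (s : ℝ) (u : Torus → ℝ) : Seq :=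
  if h : MemH s u then Seq.mk _ (memH_iff.mp h).2 else 0

theorem MemH.enc_apply {s : ℝ} {u : Torus → ℝ} (h : MemH s u) (k : Freq) :
    enc s u k = (bracket k ^ s : ℝ) * coeff u k := by
  rw [enc, dif_pos h, mk_apply]

theorem MemH.coeff_eq {s : ℝ} {u : Torus → ℝ} (h : MemH s u) (k : Freq) :
    coeff u k = (bracket k ^ (-s) : ℝ) * enc s u k := by
  rw [h.enc_apply, ← mul_assoc, ← Complex.ofReal_mul, ← Real.rpow_add (bracket_pos k)]
  simp

theorem MemH.norm_enc {s : ℝ} {u : Torus → ℝ} (h : MemH s u) : ‖enc s u‖ = hNorm s u := by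
  rw [hNorm, ← Real.sqrt_sq (norm_nonneg (enc s u)), Seq.norm_sq]
  congr 2; ext k
  rw [h.enc_apply, norm_mul, mul_pow, weight_eq, Complex.norm_real, Real.norm_eq_abs, sq_abs]

theorem MemH.enc_add {s : ℝ} {u v : Torus → ℝ} (hu : MemH s u) (hv : MemH s v) :
    enc s (fun x => u x + v x) = enc s u + enc s v := Seq.ext fun k => by
  rw [Seq.add_apply, (hu.add hv).enc_apply, hu.enc_apply, hv.enc_apply, coeff_add hu.1 hv.1, mul_add]

theorem MemH.enc_const_mul {s : ℝ} {u : Torus → ℝ} (hu : MemH s u) (c : ℝ) :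
    enc s (fun x => c * u x) = c • enc s u := Seq.ext fun k => by
  rw [Seq.smul_apply, (hu.const_mul c).enc_apply, hu.enc_apply, coeff_const_mul, mul_left_comm]

theorem MemH.enc_sub {s : ℝ} {u v : Torus → ℝ} (hu : MemH s u) (hv : MemH s v) :
    enc s (fun x => u x - v x) = enc s u - enc s v := by
  have := hu.enc_add (hv.const_mul (-1))
  rw [hv.enc_const_mul] at this
  simpa [sub_eq_add_neg] using this

theorem MemH.eq_of_enc_eq {s : ℝ} {u v : Torus → ℝ} (hs : 3 / 2 < s) (hu : MemH s u)
    (hv : MemH s v) (h : enc s u = enc s v) : u = v :=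
  hu.eq_of_coeff_eq hs hv fun k => by rw [hu.coeff_eq, hv.coeff_eq, h]

theorem MemH.reflect_enc {s : ℝ} {u : Torus → ℝ} (hu : MemH s u) :
    reflect (enc s u) = enc s u := Seq.ext fun k => by
  rw [reflect_apply, hu.enc_apply, hu.enc_apply, bracket_neg, coeff_neg, map_mul,
    Complex.conj_ofReal, Complex.conj_conj]

/-- Fixed points of `reflect` are Hermitian, and dividing by the weight makes them absolutely
summable since s > 3/2, so the Fourier series converges to a continuous real function. This is the
way back from sequences to functions. -/
theorem exists_enc_eq {s : ℝ} (hs : 3 / 2 < s) {x : Seq} (hx : reflect x = x) :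
    ∃ u, MemH s u ∧ enc s u = x := by
  have hb (k : Freq) : bracket k ^ s * bracket k ^ (-s) = 1 := by
    rw [← Real.rpow_add (bracket_pos k)]; simp
  have hsum : Summable fun k => ‖((bracket k ^ (-s) : ℝ) : ℂ) * x k‖ := by
    have h1 : Summable fun k : Freq => bracket k ^ (-(2 * s)) :=
      summable_bracket_rpow (by linarith)
    refine ((h1.add (hasSum_norm_sq x).summable).mul_left (1 / 2)).of_nonneg_of_le
      (fun _ => norm_nonneg _) fun k => ?_
    have e1 : bracket k ^ (-(2 * s)) = (bracket k ^ (-s)) ^ 2 := by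
      rw [← Real.rpow_natCast, ← Real.rpow_mul (bracket_pos k).le]; congr 1; push_cast; ring
    rw [norm_mul, Complex.norm_real, Real.norm_of_nonneg (bracket_rpow_pos _ k).le, e1]
    nlinarith [sq_nonneg (bracket k ^ (-s) - ‖x k‖)]
  obtain ⟨u, hu, huc, -⟩ := exists_coeff_eq hsum fun k => by
    conv_lhs => rw [← hx]
    rw [reflect_apply, neg_neg, bracket_neg, map_mul, Complex.conj_ofReal]
  have hk (k : Freq) : ((bracket k ^ s : ℝ) : ℂ) * coeff u k = x k := by
    rw [huc, ← mul_assoc, ← Complex.ofReal_mul, hb]; simp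
  have hm : MemH s u := memH_iff.mpr ⟨hu, by simpa only [hk] using (hasSum_norm_sq x).summable⟩
  exact ⟨u, hm, Seq.ext fun k => by rw [hm.enc_apply, hk]⟩

/-- The multiplier does not change the function; it only lowers by one the Sobolev index at which
the function is encoded. -/
theorem MemH.lam_enc {s : ℝ} {u : Torus → ℝ} (hu : MemH (s + 1) u) :
    lam (enc (s + 1) u) = enc s u := Seq.ext fun k => by
  rw [lam_apply, hu.enc_apply, (hu.mono (by linarith)).enc_apply, ← mul_assoc,
    ← Complex.ofReal_mul, Real.rpow_add_one (bracket_pos k).ne']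
  congr 2
  field_simp [(bracket_pos k).ne']

theorem MemH.mul {s : ℝ} (hs : 3 / 2 < s) {u v : Torus → ℝ} (hu : MemH s u) (hv : MemH s v) :
    MemH s (fun x => u x * v x) ∧
      enc s (fun x => u x * v x) = conv s hs (enc s u) (enc s v) := by
  have hk (k : Freq) : ((bracket k ^ s : ℝ) : ℂ) * coeff (fun x => u x * v x) k =
      conv s hs (enc s u) (enc s v) k := by
    rw [conv_apply, ← (hasSum_coeff_mul hu.1 (hu.summable_coeff hs) hv.1 k).tsum_eq]
    congr 2; ext j
    rw [convTerm, ← hu.coeff_eq, ← hv.coeff_eq]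
  have hm : MemH s fun x => u x * v x := memH_iff.mpr ⟨hu.1.mul hv.1, by
    simpa only [hk] using (hasSum_norm_sq _).summable⟩
  exact ⟨hm, Seq.ext fun k => by rw [hm.enc_apply, hk]⟩

theorem ContH.continuousOn_enc {s : ℝ} {I : Set ℝ} {u : ℝ → Torus → ℝ} (h : ContH s I u) :
    ContinuousOn (fun t => enc s (u t)) I := fun t ht => by
  rw [ContinuousWithinAt, tendsto_iff_norm_sub_tendsto_zero]
  refine (h.2 t ht).congr' ?_
  filter_upwards [self_mem_nhdsWithin] with τ hτ
  rw [← (h.1 τ hτ).enc_sub (h.1 t ht), ((h.1 τ hτ).sub (h.1 t ht)).norm_enc]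

theorem contH_of_continuousOn_enc {s : ℝ} {I : Set ℝ} {u : ℝ → Torus → ℝ}
    (hu : ∀ t ∈ I, MemH s (u t)) (h : ContinuousOn (fun t => enc s (u t)) I) : ContH s I u := by
  refine ⟨hu, fun t ht => ?_⟩
  have h1 := tendsto_iff_norm_sub_tendsto_zero.mp (h t ht)
  refine h1.congr' ?_
  filter_upwards [self_mem_nhdsWithin] with τ hτ
  rw [← (hu τ hτ).enc_sub (hu t ht), ((hu τ hτ).sub (hu t ht)).norm_enc]

theorem hasTimeDeriv_iff {s : ℝ} {I : Set ℝ} {u v : ℝ → Torus → ℝ}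
    (hu : ∀ t ∈ I, MemH s (u t)) (hv : ∀ t ∈ I, MemH s (v t)) :
    HasTimeDeriv s I u v ↔
      ∀ t ∈ I, HasDerivWithinAt (fun t => enc s (u t)) (enc s (v t)) I t := by
  refine forall₂_congr fun t ht => ?_
  rw [hasDerivWithinAt_iff_tendsto_slope,
    tendsto_iff_norm_sub_tendsto_zero (b := enc s (v t))]
  refine tendsto_congr' ?_
  filter_upwards [self_mem_nhdsWithin] with τ hτ
  have h1 := (hu τ hτ.1).sub (hu t ht)
  have h2 := h1.const_mul (τ - t)⁻¹
  have h3 := h2.sub (hv t ht)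
  have e : (fun x => (u τ x - u t x) / (τ - t) - v t x) =
      fun x => (τ - t)⁻¹ * (u τ x - u t x) - v t x := by
    ext x; ring
  rw [e, ← h3.norm_enc, h2.enc_sub (hv t ht), h1.enc_const_mul, (hu τ hτ.1).enc_sub (hu t ht),
    slope_def_module]

/-! ### Radial retraction and global solutions of Lipschitz equations -/

section ODE

variable {E : Type*} [NormedAddCommGroup E] [NormedSpace ℝ E]

/-- The radial retraction onto the closed ball of radius `R`. -/
def retr (R : ℝ) (x : E) : E := (R / max R ‖x‖) • x

theorem retr_of_norm_le {R : ℝ} (hR : 0 < R) {x : E} (hx : ‖x‖ ≤ R) : retr R x = x := by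
  rw [retr, max_eq_left hx, div_self hR.ne', one_smul]

theorem norm_retr_le {R : ℝ} (hR : 0 < R) (x : E) : ‖retr R x‖ ≤ R := by
  have hm : 0 < max R ‖x‖ := lt_max_of_lt_left hR
  rw [retr, norm_smul, Real.norm_of_nonneg (by positivity), div_mul_eq_mul_div, div_le_iff₀ hm]
  exact mul_le_mul_of_nonneg_left (le_max_right _ _) hR.le

theorem norm_retr_le_norm {R : ℝ} (hR : 0 < R) (x : E) : ‖retr R x‖ ≤ ‖x‖ := by
  have hm : 0 < max R ‖x‖ := lt_max_of_lt_left hR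
  rw [retr, norm_smul, Real.norm_of_nonneg (by positivity)]
  exact mul_le_of_le_one_left (norm_nonneg x) ((div_le_one hm).mpr (le_max_left _ _))

/-- The difference splits into a contraction of x - y and a multiple of y caused by the change of
scaling factor. Each part contributes at most ‖x - y‖, whence the constant 2. -/
theorem norm_retr_sub_le {R : ℝ} (hR : 0 < R) (x y : E) :
    ‖retr R x - retr R y‖ ≤ 2 * ‖x - y‖ := by
  set a := max R ‖x‖ with ha
  set b := max R ‖y‖ with hb
  have ha0 : 0 < a := lt_max_of_lt_left hR
  have hb0 : 0 < b := lt_max_of_lt_left hR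
  have hRa : R ≤ a := le_max_left _ _
  have hyb : ‖y‖ ≤ b := le_max_right _ _
  have hab : |b - a| ≤ ‖x - y‖ := by
    rw [ha, hb, abs_sub_comm]
    calc |max R ‖x‖ - max R ‖y‖| ≤ max |R - R| |‖x‖ - ‖y‖| := abs_max_sub_max_le_max _ _ _ _
      _ ≤ ‖x - y‖ := by
        rw [sub_self, abs_zero]
        exact max_le (norm_nonneg _) (abs_norm_sub_norm_le x y)
  have e : retr R x - retr R y = (R / a) • (x - y) + (R / a * ((b - a) / b)) • y := by
    have : R / b = R / a - R / a * ((b - a) / b) := by field_simp; ring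
    rw [retr, retr, ← ha, ← hb, this]
    module
  have hRa1 : R / a ≤ 1 := (div_le_one ha0).mpr hRa
  have hRa0 : 0 ≤ R / a := by positivity
  rw [e]
  refine (norm_add_le _ _).trans ?_
  rw [norm_smul, norm_smul, Real.norm_of_nonneg hRa0, norm_mul, Real.norm_of_nonneg hRa0,
    norm_div, Real.norm_eq_abs, Real.norm_of_nonneg hb0.le]
  have h1 : R / a * ‖x - y‖ ≤ ‖x - y‖ := mul_le_of_le_one_left (norm_nonneg _) hRa1
  have h2 : R / a * (|b - a| / b) * ‖y‖ ≤ |b - a| := by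
    calc R / a * (|b - a| / b) * ‖y‖ ≤ 1 * (|b - a| / b) * b := by gcongr
      _ = |b - a| := by field_simp
  linarith

theorem lipschitzWith_retr {R : ℝ} (hR : 0 < R) : LipschitzWith 2 (retr R : E → E) :=
  LipschitzWith.of_dist_le_mul fun x y => by
    simpa [dist_eq_norm] using norm_retr_sub_le hR x y

/-- Global Lipschitz continuity gives linear growth, so Gronwall bounds any solution a priori.
Truncating the field beyond that bound makes it bounded, so one application of Picard–Lindelöf
covers the whole interval, and the bound then shows that the truncation was inactive. -/
theorem exists_solution_on_Icc [CompleteSpace E] {G : ℝ → E → E} {K : NNReal} {b : ℝ}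
    (hb : 0 ≤ b) (hG : ∀ t ∈ Set.Icc 0 b, LipschitzWith K (G t))
    (hc : ∀ x, ContinuousOn (fun t => G t x) (Set.Icc 0 b)) (x₀ : E) :
    ∃ y : ℝ → E, y 0 = x₀ ∧
      ∀ t ∈ Set.Icc 0 b, HasDerivWithinAt y (G t (y t)) (Set.Icc 0 b) t := by
  obtain ⟨M, hM⟩ := isCompact_Icc.exists_bound_of_continuousOn (hc 0)
  have hM0 : 0 ≤ M := (norm_nonneg _).trans (hM 0 ⟨le_rfl, hb⟩)
  have hgrow (t : ℝ) (ht : t ∈ Set.Icc 0 b) (x : E) : ‖G t x‖ ≤ K * ‖x‖ + M := by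
    have h1 := (hG t ht).norm_sub_le x 0
    rw [sub_zero] at h1
    have h2 := norm_add_le (G t x - G t 0) (G t 0)
    rw [sub_add_cancel] at h2
    linarith [hM t ht]
  set R : ℝ := gronwallBound ‖x₀‖ K M b + 1 with hRdef
  have hmono := gronwallBound_mono (norm_nonneg x₀) hM0 K.coe_nonneg
  have hR : 0 < R := by
    have := hmono hb
    rw [gronwallBound_x0] at this
    linarith [norm_nonneg x₀]
  have hL0 : 0 ≤ K * R + M := by positivity
  -- The truncated field is bounded by K R + M everywhere, so a ball of radius (K R + M) b around
  -- the initial value cannot be left before time b.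
  have hP : IsPicardLindelof (fun t x => G t (retr R x)) (tmin := 0) (tmax := b)
      ⟨0, le_rfl, hb⟩ x₀ ⟨(K * R + M) * b, by positivity⟩ 0 ⟨K * R + M, hL0⟩ (K * 2) := by
    refine ⟨fun t ht => ((hG t ht).comp (lipschitzWith_retr hR)).lipschitzOnWith,
      fun x _ => hc _, fun t ht x _ => ?_, ?_⟩
    · refine (hgrow t ht _).trans ?_
      change _ ≤ K * R + M
      gcongr
      exact norm_retr_le hR x
    · change (K * R + M) * max (b - 0) (0 - 0) ≤ (K * R + M) * b - 0
      rw [sub_self, sub_zero, sub_zero, max_eq_left hb]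
  obtain ⟨y, hy0, hy⟩ := hP.exists_eq_forall_mem_Icc_hasDerivWithinAt₀
  have hbound := norm_le_gronwallBound_of_norm_deriv_right_le (δ := ‖x₀‖) (K := K) (ε := M)
    (fun t ht => (hy t ht).continuousWithinAt)
    (fun t ht => (hy t (Set.Ico_subset_Icc_self ht)).mono_of_mem_nhdsWithin
      (Icc_mem_nhdsGE_of_mem ht)) (by rw [show y 0 = x₀ from hy0])
    (fun t ht => (hgrow t (Set.Ico_subset_Icc_self ht) _).trans (by
      gcongr; exact norm_retr_le_norm hR _))
  refine ⟨y, hy0, fun t ht => ?_⟩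
  have h1 := hy t ht
  rwa [retr_of_norm_le hR] at h1
  have h2 := hbound t ht
  have h3 := hmono (show t - 0 ≤ b by linarith [ht.2])
  linarith

theorem eqOn_of_lipschitz {G : ℝ → E → E} {K : NNReal} {b : ℝ}
    (hG : ∀ t ∈ Set.Icc 0 b, LipschitzWith K (G t)) {y z : ℝ → E}
    (hy : ∀ t ∈ Set.Icc 0 b, HasDerivWithinAt y (G t (y t)) (Set.Icc 0 b) t)
    (hz : ∀ t ∈ Set.Icc 0 b, HasDerivWithinAt z (G t (z t)) (Set.Icc 0 b) t)
    (h0 : y 0 = z 0) : Set.EqOn y z (Set.Icc 0 b) :=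
  ODE_solution_unique_of_mem_Icc_right (v := G) (s := fun _ => Set.univ)
    (fun t ht => (hG t (Set.Ico_subset_Icc_self ht)).lipschitzOnWith)
    (fun t ht => (hy t ht).continuousWithinAt)
    (fun t ht => (hy t (Set.Ico_subset_Icc_self ht)).mono_of_mem_nhdsWithin
      (Icc_mem_nhdsGE_of_mem ht)) (fun _ _ => trivial)
    (fun t ht => (hz t ht).continuousWithinAt)
    (fun t ht => (hz t (Set.Ico_subset_Icc_self ht)).mono_of_mem_nhdsWithin
      (Icc_mem_nhdsGE_of_mem ht)) (fun _ _ => trivial) h0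

theorem exists_global_solution [CompleteSpace E] {G : ℝ → E → E} {K : NNReal}
    (hG : ∀ t, 0 ≤ t → LipschitzWith K (G t))
    (hc : ∀ x, ContinuousOn (fun t => G t x) (Set.Ici 0)) (x₀ : E) :
    ∃ y : ℝ → E, y 0 = x₀ ∧
      ∀ t, 0 ≤ t → HasDerivWithinAt y (G t (y t)) (Set.Ici 0) t := by
  have hex (n : ℕ) := exists_solution_on_Icc (b := n) n.cast_nonneg (fun t ht => hG t ht.1)
    (fun x => (hc x).mono Set.Icc_subset_Ici_self) x₀
  choose α hα0 hα using hex
  have hagree {n l : ℕ} (h : n ≤ l) : Set.EqOn (α n) (α l) (Set.Icc 0 n) :=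
    eqOn_of_lipschitz (fun t ht => hG t ht.1) (hα n)
      (fun t ht => (hα l t ⟨ht.1, ht.2.trans (by exact_mod_cast h)⟩).mono
        (Set.Icc_subset_Icc_right (by exact_mod_cast h))) ((hα0 n).trans (hα0 l).symm)
  -- The solutions on the intervals [0, n] agree by uniqueness, so any n ≥ t may be used to evaluate
  -- at t. For the derivative, n is later taken strictly larger than t.
  let y : ℝ → E := fun t => α ⌈t⌉₊ t
  have hy {n : ℕ} : Set.EqOn y (α n) (Set.Icc 0 n) := fun t ht => by
    have h1 : ⌈t⌉₊ ≤ n := Nat.ceil_le.mpr ht.2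
    exact hagree h1 ⟨ht.1, Nat.le_ceil t⟩
  refine ⟨y, by simpa using hy (n := 0) (x := 0) (by simp) ▸ hα0 0, fun t ht => ?_⟩
  obtain ⟨n, hn⟩ := exists_nat_gt t
  have htn : t ∈ Set.Icc (0 : ℝ) n := ⟨ht, hn.le⟩
  have h1 := (hα n t htn).congr_of_mem hy htn
  rw [← hy htn] at h1
  refine h1.mono_of_mem_nhdsWithin ?_
  rw [← Set.Ici_inter_Iic]
  exact inter_mem self_mem_nhdsWithin (mem_nhdsWithin_of_mem_nhds (Iic_mem_nhds hn))

end ODE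

/-! ### The diagonalised evolution equation -/

/-- The weighted coefficients of `u`, as a function of those of `ω u + i (∂_t u + κ u)`. -/
def posPart : Seq →L[ℝ] Seq := lam ∘L ((1 / 2 : ℝ) • (ContinuousLinearMap.id ℝ Seq + reflect))

theorem posPart_eq (x : Seq) : posPart x = lam ((1 / 2 : ℝ) • (x + reflect x)) := rfl

theorem posPart_apply (x : Seq) (k : Freq) :
    posPart x k = ((bracket k)⁻¹ : ℝ) * ((1 / 2 : ℝ) * (x k + starRingEnd ℂ (x (-k)))) := by
  rw [posPart_eq, lam_apply, Seq.smul_apply, Seq.add_apply, reflect_apply]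

theorem norm_lam_le (x : Seq) : ‖lam x‖ ≤ ‖x‖ := norm_diag_le _ _ x

/-- Taking the real part is a contraction, and so is ω⁻¹ because ω ≥ 1. This spectral gap lets the
damping κ beat the perturbation κ²u in the energy estimate. -/
theorem norm_posPart_le (x : Seq) : ‖posPart x‖ ≤ ‖x‖ := by
  rw [posPart_eq]
  refine (norm_lam_le _).trans ?_
  rw [norm_smul, Real.norm_of_nonneg (by norm_num)]
  linarith [norm_add_le x (reflect x), norm_reflect_le x]

theorem reflect_posPart (x : Seq) : reflect (posPart x) = posPart x := Seq.ext fun k => by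
  rw [reflect_apply, posPart_apply, posPart_apply]
  simp only [map_mul, map_add, Complex.conj_ofReal, Complex.conj_conj, neg_neg, bracket_neg]
  ring

theorem offProj_posPart (x : Seq) : offProj (posPart x) = posPart (offProj x) :=
  Seq.ext fun k => by
    rw [offProj_apply, posPart_apply, posPart_apply, offProj_apply, offProj_apply]
    by_cases h : k = 0 <;> simp [h]

theorem offProj_evol (t : ℝ) (x : Seq) : offProj (evol t x) = evol t (offProj x) :=
  Seq.ext fun k => by
    rw [offProj_apply, evol_apply, evol_apply, offProj_apply]; ring

theorem offProj_mulI (x : Seq) : offProj (mulI x) = mulI (offProj x) :=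
  Seq.ext fun k => by
    rw [offProj_apply, mulI_apply, mulI_apply, offProj_apply]; ring

theorem offProj_zeroProj (x : Seq) : offProj (zeroProj x) = 0 :=
  Seq.ext fun k => by
    rw [offProj_apply, zeroProj_apply, Seq.zero_apply]
    split_ifs <;> simp

theorem norm_mulI_le (x : Seq) : ‖mulI x‖ ≤ ‖x‖ := norm_diag_le _ _ x

theorem norm_zeroProj_le (x : Seq) : ‖zeroProj x‖ ≤ ‖x‖ := norm_diag_le _ _ x

theorem norm_offProj_le (x : Seq) : ‖offProj x‖ ≤ ‖x‖ := norm_diag_le _ _ x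

/-- The right side of the equation in the interaction picture, with source `F`. -/
def rhs (κ t : ℝ) (W F : Seq) : Seq :=
  (-κ) • W + evol t (mulI (κ ^ 2 • posPart (evol (-t) W) + zeroProj (posPart (evol (-t) W)) +
    Real.exp (-κ * t) • F))

/-- The right side is jointly linear in state and source, so the bound `norm_rhs_le` is also a
Lipschitz bound. -/
theorem rhs_sub (κ t : ℝ) (W W' F F' : Seq) :
    rhs κ t W F - rhs κ t W' F' = rhs κ t (W - W') (F - F') := by
  simp only [rhs, map_sub, smul_sub, map_add]
  abel

theorem exp_neg_mul_le_one {κ t : ℝ} (hκ : 0 ≤ κ) (ht : 0 ≤ t) : Real.exp (-κ * t) ≤ 1 :=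
  Real.exp_le_one_iff.mpr (by nlinarith)

theorem norm_rhs_le {κ t : ℝ} (hκ : 0 ≤ κ) (ht : 0 ≤ t) (W F : Seq) :
    ‖rhs κ t W F‖ ≤ (κ + κ ^ 2 + 1) * ‖W‖ + ‖F‖ := by
  have h1 := norm_add_le ((-κ) • W) (evol t (mulI (κ ^ 2 • posPart (evol (-t) W) +
    zeroProj (posPart (evol (-t) W)) + Real.exp (-κ * t) • F)))
  rw [norm_evol, norm_smul, norm_neg, Real.norm_of_nonneg hκ] at h1
  have h2 := norm_mulI_le (κ ^ 2 • posPart (evol (-t) W) +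
    zeroProj (posPart (evol (-t) W)) + Real.exp (-κ * t) • F)
  have h3 := norm_add₃_le (a := κ ^ 2 • posPart (evol (-t) W))
    (b := zeroProj (posPart (evol (-t) W))) (c := Real.exp (-κ * t) • F)
  rw [norm_smul, norm_smul, Real.norm_of_nonneg (sq_nonneg κ),
    Real.norm_of_nonneg (Real.exp_pos _).le] at h3
  have h4 := norm_posPart_le (evol (-t) W)
  rw [norm_evol] at h4
  have h5 := norm_zeroProj_le (posPart (evol (-t) W))
  have h6 := mul_le_mul_of_nonneg_right (exp_neg_mul_le_one hκ ht) (norm_nonneg F)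
  have h7 := mul_le_mul_of_nonneg_left h4 (sq_nonneg κ)
  change ‖rhs κ t W F‖ ≤ _ at h1
  linarith

theorem continuousOn_evol {I : Set ℝ} {t' : ℝ → ℝ} {x : ℝ → Seq} (ht : ContinuousOn t' I)
    (hx : ContinuousOn x I) : ContinuousOn (fun t => evol (t' t) (x t)) I :=
  Continuous.comp_continuousOn (g := fun p : ℝ × Seq => evol p.1 p.2) continuous_evol
    (ht.prodMk hx)

theorem continuousOn_posPart_evol {I : Set ℝ} {W : ℝ → Seq} (hW : ContinuousOn W I) :
    ContinuousOn (fun t => posPart (evol (-t) (W t))) I :=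
  posPart.continuous.comp_continuousOn (continuousOn_evol continuousOn_neg hW)

theorem continuousOn_rhs {κ : ℝ} {I : Set ℝ} {W F : ℝ → Seq} (hW : ContinuousOn W I)
    (hF : ContinuousOn F I) : ContinuousOn (fun t => rhs κ t (W t) (F t)) I := by
  have hU := continuousOn_posPart_evol hW
  have hexp : ContinuousOn (fun t => Real.exp (-κ * t)) I := by fun_prop
  have h1 : ContinuousOn (fun t => κ ^ 2 • posPart (evol (-t) (W t))) I := hU.const_smul (κ ^ 2)
  have h2 : ContinuousOn (fun t => zeroProj (posPart (evol (-t) (W t)))) I :=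
    zeroProj.continuous.comp_continuousOn hU
  have h3 : ContinuousOn (fun t => Real.exp (-κ * t) • F t) I := hexp.smul hF
  have h4 : ContinuousOn (fun t => mulI (κ ^ 2 • posPart (evol (-t) (W t)) +
      zeroProj (posPart (evol (-t) (W t))) + Real.exp (-κ * t) • F t)) I :=
    mulI.continuous.comp_continuousOn ((h1.add h2).add h3)
  have h5 : ContinuousOn (fun t => (-κ) • W t) I := hW.const_smul (-κ)
  exact h5.add (continuousOn_evol (t' := fun t => t) continuousOn_id h4)

/-- The energy estimate: a small source keeps the nonzero modes bounded. -/
theorem norm_offProj_le_of_solution {κ α η : ℝ} (hκ0 : 0 < κ) (hα : 0 < α)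
    (hη : η < (κ - κ ^ 2) * α) {W F : ℝ → Seq}
    (hW : ∀ t, 0 ≤ t → HasDerivWithinAt W (rhs κ t (W t) (F t)) (Set.Ici 0) t)
    (hF : ∀ t, 0 ≤ t → ‖F t‖ ≤ η) (h0 : ‖offProj (W 0)‖ ≤ α) :
    ∀ t, 0 ≤ t → ‖offProj (W t)‖ ≤ α := by
  have hd (t : ℝ) (ht : 0 ≤ t) := (offProj.hasFDerivAt.comp_hasDerivWithinAt t (hW t ht)).norm_sq
  intro T hT
  -- This is a barrier argument: the derivative of the squared norm has to be negative only at times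
  -- when the norm equals α.
  have hle := image_le_of_deriv_right_lt_deriv_boundary (a := 0) (b := T)
    (f := fun t => ‖offProj (W t)‖ ^ 2) (B := fun _ => α ^ 2) (B' := fun _ => 0)
    (fun t ht => ((hd t ht.1).continuousWithinAt).mono Set.Icc_subset_Ici_self)
    (fun t ht => (hd t ht.1).mono (Set.Ici_subset_Ici.mpr ht.1))
    (pow_le_pow_left₀ (norm_nonneg _) h0 2) (fun t => hasDerivAt_const t _) ?_ ⟨hT, le_rfl⟩
  · exact (pow_le_pow_iff_left₀ (norm_nonneg _) hα.le two_ne_zero).mp hle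
  intro t ht he
  have he' : ‖offProj (W t)‖ = α :=
    (pow_left_inj₀ (norm_nonneg _) hα.le two_ne_zero).mp he
  set X := offProj (W t)
  -- The correction P₀u disappears on the nonzero modes, and the equation for them involves no other
  -- part of the state except through the source.
  have e : offProj (rhs κ t (W t) (F t)) = (-κ) • X + evol t (mulI
      (κ ^ 2 • posPart (evol (-t) X) + Real.exp (-κ * t) • offProj (F t))) := by
    simp only [rhs, map_add, map_smul, offProj_evol, offProj_mulI, offProj_posPart,
      offProj_zeroProj, add_zero, X, map_zero]
  change 2 * inner ℝ X (offProj (rhs κ t (W t) (F t))) < 0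
  rw [e, inner_add_right, inner_smul_right, real_inner_self_eq_norm_sq, he']
  set Y := κ ^ 2 • posPart (evol (-t) X) + Real.exp (-κ * t) • offProj (F t)
  have h1 := real_inner_le_norm X (evol t (mulI Y))
  rw [norm_evol, he'] at h1
  have h2 : ‖Y‖ ≤ κ ^ 2 * α + η := by
    refine (norm_add_le _ _).trans ?_
    rw [norm_smul, norm_smul, Real.norm_of_nonneg (sq_nonneg κ),
      Real.norm_of_nonneg (Real.exp_pos _).le]
    have h4 := norm_posPart_le (evol (-t) X)
    rw [norm_evol, he'] at h4
    have h5 := (norm_offProj_le (F t)).trans (hF t ht.1)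
    have h6 := mul_le_mul_of_nonneg_right (exp_neg_mul_le_one hκ0.le ht.1)
      (norm_nonneg (offProj (F t)))
    have h7 := mul_le_mul_of_nonneg_left h4 (sq_nonneg κ)
    linarith
  have h3 := (norm_mulI_le Y).trans h2
  have h4 : ‖mulI Y‖ < κ * α := by nlinarith
  nlinarith

theorem rhs_apply (κ t : ℝ) (W F : Seq) (k : Freq) :
    rhs κ t W F k = -κ * W k + Complex.exp (Complex.I * (t * bracket k : ℝ)) * (Complex.I *
      (κ ^ 2 * posPart (evol (-t) W) k + (if k = 0 then 1 else 0) * posPart (evol (-t) W) k +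
        Real.exp (-κ * t) * F k)) := by
  rw [rhs, Seq.add_apply, Seq.smul_apply, evol_apply, mulI_apply, Seq.add_apply, Seq.add_apply,
    Seq.smul_apply, Seq.smul_apply, zeroProj_apply]
  push_cast
  ring

theorem evol_neg_apply_hasDeriv {t : ℝ} {I : Set ℝ} {W : ℝ → Seq} {D : Seq}
    (hW : HasDerivWithinAt W D I t) (k : Freq) :
    HasDerivWithinAt (fun t => evol (-t) (W t) k)
      (-Complex.I * bracket k * evol (-t) (W t) k + evol (-t) D k) I t := by
  have h1 : HasDerivWithinAt (fun t => W t k) (D k) I t :=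
    (evalCLM k).hasFDerivAt.comp_hasDerivWithinAt t hW
  have h2 : HasDerivAt (fun t : ℝ => Complex.I * (-t * bracket k : ℝ))
      (-Complex.I * bracket k) t := by
    have := (Complex.ofRealCLM.hasDerivAt (x := t)).const_mul (-Complex.I * bracket k)
    simp only [Complex.ofRealCLM_apply, Complex.ofReal_one, mul_one] at this
    refine this.congr_of_eventuallyEq (Eventually.of_forall fun τ => ?_)
    push_cast; ring
  simp only [evol_apply]
  exact (h2.cexp.hasDerivWithinAt.mul h1).congr_deriv (by ring)

/-- The equation satisfied by the entries of `Z = evol (-t) W`. -/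
theorem hasDeriv_evol_neg {κ t : ℝ} {I : Set ℝ} {W F : ℝ → Seq}
    (hW : HasDerivWithinAt W (rhs κ t (W t) (F t)) I t) (k : Freq) :
    HasDerivWithinAt (fun t => evol (-t) (W t) k)
      (-Complex.I * bracket k * evol (-t) (W t) k - κ * evol (-t) (W t) k + Complex.I *
      (κ ^ 2 * posPart (evol (-t) (W t)) k +
        (if k = 0 then 1 else 0) * posPart (evol (-t) (W t)) k +
        Real.exp (-κ * t) * F t k)) I t := by
  refine (evol_neg_apply_hasDeriv hW k).congr_deriv ?_
  rw [rhs, map_add, map_smul, evol_neg_evol, Seq.add_apply, Seq.smul_apply, mulI_apply,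
    Seq.add_apply, Seq.add_apply, Seq.smul_apply, Seq.smul_apply, zeroProj_apply]
  push_cast
  ring

/-- The zero mode stays small. -/
theorem norm_posPart_zero_le_of_solution {κ η : ℝ} (hκ0 : 0 < κ) {W F : ℝ → Seq}
    (hW : ∀ t, 0 ≤ t → HasDerivWithinAt W (rhs κ t (W t) (F t)) (Set.Ici 0) t)
    (hF : ∀ t, 0 ≤ t → ‖F t‖ ≤ η) (hFr : ∀ t, 0 ≤ t → reflect (F t) = F t) (h0 : W 0 0 = 0) :
    ∀ t, 0 ≤ t → ‖posPart (evol (-t) (W t)) 0‖ ≤ η / κ ^ 2 := by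
  have hη : 0 ≤ η := (norm_nonneg _).trans (hF 0 le_rfl)
  let z : ℝ → ℂ := fun t => evol (-t) (W t) 0
  have hpos (t : ℝ) : posPart (evol (-t) (W t)) 0 = ((z t).re : ℂ) := by
    rw [posPart_apply, neg_zero, Complex.add_conj, bracket_zero]
    push_cast; simp [z]
  have hFim (t : ℝ) (ht : 0 ≤ t) : (F t 0).im = 0 := by
    have h1 := congrArg (fun x : Seq => x 0) (hFr t ht)
    simp only [reflect_apply, neg_zero] at h1
    exact Complex.conj_eq_iff_im.mp h1
  have hz (t : ℝ) (ht : 0 ≤ t) := hasDeriv_evol_neg (hW t ht) 0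
  -- At k = 0 the state is z = û₀ + i(û₀' + κû₀). The artificial frequency ω = 1 and the correction
  -- P₀u cancel in the equation for the imaginary part.
  have hre (t : ℝ) (ht : 0 ≤ t) : HasDerivWithinAt (fun t => (z t).re)
      ((z t).im - κ * (z t).re) (Set.Ici 0) t := by
    refine (Complex.reCLM.hasFDerivAt.comp_hasDerivWithinAt t (hz t ht)).congr_deriv ?_
    rw [hpos, bracket_zero]
    generalize Real.exp (-κ * t) = r
    simp [hFim t ht, z, pow_two]
  have him (t : ℝ) (ht : 0 ≤ t) : HasDerivWithinAt (fun t => (z t).im)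
      (-κ * (z t).im + κ ^ 2 * (z t).re + Real.exp (-κ * t) * (F t 0).re) (Set.Ici 0) t := by
    refine (Complex.imCLM.hasFDerivAt.comp_hasDerivWithinAt t (hz t ht)).congr_deriv ?_
    rw [hpos, bracket_zero]
    generalize Real.exp (-κ * t) = r
    simp [z, pow_two]
    ring
  have hz0 : z 0 = 0 := by simp [z, evol_apply, h0]
  have hexp (c t : ℝ) : HasDerivAt (fun t => Real.exp (c * t)) (c * Real.exp (c * t)) t := by
    simpa [mul_comm] using ((hasDerivAt_id t).const_mul c).exp
  -- This is û₀'. The integrating factor e^{2κt} leaves e^{κt}F̂₀, so |û₀'| ≤ (η/κ)e^{-κt}, which is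
  -- integrable in time.
  let p : ℝ → ℝ := fun t => (z t).im - κ * (z t).re
  have hp (t : ℝ) (ht : 0 ≤ t) : HasDerivWithinAt (fun t => Real.exp (2 * κ * t) * p t)
      (Real.exp (κ * t) * (F t 0).re) (Set.Ici 0) t := by
    have h1 : HasDerivWithinAt p _ (Set.Ici 0) t := (him t ht).sub ((hre t ht).const_mul κ)
    refine ((hexp (2 * κ) t).hasDerivWithinAt.mul h1).congr_deriv ?_
    have e : Real.exp (κ * t) = Real.exp (2 * κ * t) * Real.exp (-κ * t) := by
      rw [← Real.exp_add]; congr 1; ring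
    rw [e]; simp only [p]; ring
  have hpb (t : ℝ) (ht : 0 ≤ t) : ‖Real.exp (2 * κ * t) * p t‖ ≤ η / κ * Real.exp (κ * t) := by
    refine image_norm_le_of_norm_deriv_right_le_deriv_boundary (a := 0) (b := t)
      (f := fun t => Real.exp (2 * κ * t) * p t) (B := fun t => η / κ * Real.exp (κ * t))
      (B' := fun t => η * Real.exp (κ * t))
      (fun τ hτ => ((hp τ hτ.1).continuousWithinAt).mono Set.Icc_subset_Ici_self)
      (fun τ hτ => (hp τ hτ.1).mono (Set.Ici_subset_Ici.mpr hτ.1)) ?_ (fun τ => ?_) ?_ ⟨ht, le_rfl⟩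
    · simp only [p, hz0]; simp; positivity
    · refine ((hexp κ τ).const_mul (η / κ)).congr_deriv ?_
      field_simp
    · intro τ hτ
      rw [norm_mul, Real.norm_of_nonneg (Real.exp_pos _).le, mul_comm]
      gcongr
      exact ((Complex.abs_re_le_norm _).trans (norm_apply_le _ _)).trans (hF τ hτ.1)
  intro T hT
  have hfin : ‖(z T).re‖ ≤ η / κ ^ 2 - η / κ ^ 2 * Real.exp (-κ * T) := by
    refine image_norm_le_of_norm_deriv_right_le_deriv_boundary (a := 0) (b := T)
      (f := fun t => (z t).re) (B := fun t => η / κ ^ 2 - η / κ ^ 2 * Real.exp (-κ * t))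
      (B' := fun t => η / κ * Real.exp (-κ * t))
      (fun τ hτ => ((hre τ hτ.1).continuousWithinAt).mono Set.Icc_subset_Ici_self)
      (fun τ hτ => (hre τ hτ.1).mono (Set.Ici_subset_Ici.mpr hτ.1)) ?_ (fun τ => ?_) ?_ ⟨hT, le_rfl⟩
    · simp [hz0]
    · refine (((hexp (-κ) τ).const_mul (η / κ ^ 2)).const_sub (η / κ ^ 2)).congr_deriv ?_
      field_simp
    · intro τ hτ
      have h1 := hpb τ hτ.1
      rw [norm_mul, Real.norm_of_nonneg (Real.exp_pos _).le] at h1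
      have e : Real.exp (κ * τ) = Real.exp (2 * κ * τ) * Real.exp (-κ * τ) := by
        rw [← Real.exp_add]; congr 1; ring
      rw [e, mul_left_comm] at h1
      exact le_of_mul_le_mul_left h1 (Real.exp_pos _)
  rw [hpos, Complex.norm_real]
  have : 0 ≤ η / κ ^ 2 * Real.exp (-κ * T) := by positivity
  linarith

/-! ### The cubic source -/

section Cubic

variable {m : ℝ} (hm : 3 / 2 < m)

/-- The sequence form of `a (1 + u)³`. -/
def cubic (A U : Seq) : Seq :=
  conv m hm A (conv m hm (enc m (fun _ => 1) + U)
    (conv m hm (enc m (fun _ => 1) + U) (enc m (fun _ => 1) + U)))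

theorem continuous_cubic : Continuous fun p : Seq × Seq => cubic hm p.1 p.2 := by
  unfold cubic; fun_prop

/-- A bound for the cubic source and for its Lipschitz constant on the ball of radius `R`. -/
def cubicConst (R : ℝ) : ℝ :=
  3 * (‖conv m hm‖ + 1) ^ 3 * (‖enc m fun _ => (1 : ℝ)‖ + R + 1) ^ 3

theorem norm_conv_le (x y : Seq) : ‖conv m hm x y‖ ≤ (‖conv m hm‖ + 1) * ‖x‖ * ‖y‖ := by
  refine ((conv m hm).le_opNorm₂ x y).trans ?_
  gcongr
  linarith

theorem cubicConst_pos {R : ℝ} (hR : 0 ≤ R) : 0 < cubicConst hm R := by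
  unfold cubicConst; positivity

theorem norm_cubic_le {R : ℝ} (A : Seq) {U : Seq} (hU : ‖U‖ ≤ R) :
    ‖cubic hm A U‖ ≤ cubicConst hm R * ‖A‖ := by
  have hR : 0 ≤ R := (norm_nonneg _).trans hU
  set B := ‖conv m hm‖ + 1 with hB
  have hB0 : 0 ≤ B := by positivity
  set D := ‖enc m fun _ => (1 : ℝ)‖ + R + 1 with hD
  have hD0 : 0 ≤ D := by positivity
  set X := enc m (fun _ => 1) + U with hX
  have hXD : ‖X‖ ≤ D := (norm_add_le _ _).trans (by linarith)
  have h1 : ‖conv m hm X X‖ ≤ B * D * D := (norm_conv_le hm X X).trans (by gcongr)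
  have h2 : ‖conv m hm X (conv m hm X X)‖ ≤ B * D * (B * D * D) :=
    (norm_conv_le hm _ _).trans (by gcongr)
  have h3 : ‖cubic hm A U‖ ≤ B * ‖A‖ * (B * D * (B * D * D)) :=
    (norm_conv_le hm _ _).trans (by gcongr)
  refine h3.trans ?_
  rw [cubicConst, ← hB, ← hD]
  have : 0 ≤ B ^ 3 * D ^ 3 * ‖A‖ := by positivity
  nlinarith

theorem norm_cubic_sub_le {R : ℝ} (A : Seq) {U V : Seq} (hU : ‖U‖ ≤ R) (hV : ‖V‖ ≤ R) :
    ‖cubic hm A U - cubic hm A V‖ ≤ cubicConst hm R * ‖A‖ * ‖U - V‖ := by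
  have hR : 0 ≤ R := (norm_nonneg _).trans hU
  set B := ‖conv m hm‖ + 1 with hB
  have hB0 : 0 ≤ B := by positivity
  set D := ‖enc m fun _ => (1 : ℝ)‖ + R + 1 with hD
  have hD1 : 1 ≤ D := by have := norm_nonneg (enc m fun _ => (1 : ℝ)); linarith
  have hD0 : 0 ≤ D := by linarith
  set X := enc m (fun _ => 1) + U with hX
  set Y := enc m (fun _ => 1) + V with hY
  have hXD : ‖X‖ ≤ D := (norm_add_le _ _).trans (by linarith)
  have hYD : ‖Y‖ ≤ D := (norm_add_le _ _).trans (by linarith)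
  have hUV : U - V = X - Y := by rw [hX, hY]; abel
  rw [hUV]
  set d := ‖X - Y‖ with hd
  -- Telescoping X³ - Y³ = (X-Y)X² + Y(X-Y)X + Y²(X-Y) produces three terms of equal size, the
  -- source of the factor 3 in `cubicConst`.
  have e : cubic hm A U - cubic hm A V = conv m hm A (conv m hm (X - Y) (conv m hm X X) +
      (conv m hm Y (conv m hm (X - Y) X) + conv m hm Y (conv m hm Y (X - Y)))) := by
    simp only [cubic, ← hX, ← hY, map_sub, map_add, _root_.sub_apply]
    abel
  have h1 : ‖conv m hm X X‖ ≤ B * D * D := (norm_conv_le hm X X).trans (by gcongr)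
  have h2 : ‖conv m hm (X - Y) X‖ ≤ B * d * D := (norm_conv_le hm _ _).trans (by gcongr)
  have h3 : ‖conv m hm Y (X - Y)‖ ≤ B * D * d := (norm_conv_le hm _ _).trans (by gcongr)
  have h4 : ‖conv m hm (X - Y) (conv m hm X X)‖ ≤ B * d * (B * D * D) :=
    (norm_conv_le hm _ _).trans (by gcongr)
  have h5 : ‖conv m hm Y (conv m hm (X - Y) X)‖ ≤ B * D * (B * d * D) :=
    (norm_conv_le hm _ _).trans (by gcongr)
  have h6 : ‖conv m hm Y (conv m hm Y (X - Y))‖ ≤ B * D * (B * D * d) :=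
    (norm_conv_le hm _ _).trans (by gcongr)
  have h7 := (norm_add_le _ _).trans (add_le_add h4 ((norm_add_le _ _).trans (add_le_add h5 h6)))
  rw [e]
  refine (norm_conv_le hm _ _).trans ?_
  rw [← hB]
  calc B * ‖A‖ * _ ≤ B * ‖A‖ * (B * d * (B * D * D) + (B * D * (B * d * D) +
        B * D * (B * D * d))) := by gcongr
    _ = 3 * B ^ 3 * (D ^ 2 * 1) * ‖A‖ * d := by ring
    _ ≤ 3 * B ^ 3 * (D ^ 2 * D) * ‖A‖ * d := by gcongr
    _ = _ := by rw [cubicConst, ← hB, ← hD]; ring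

theorem enc_source (a : ℝ → Torus → ℝ) {t : ℝ} {u : Torus → ℝ} (ha : MemH m (a t))
    (hu : MemH m u) :
    MemH m (source a t u) ∧ enc m (source a t u) = cubic hm (enc m (a t)) (enc m u) := by
  have h1 := (memH_const m 1).add hu
  have h2 := h1.mul hm h1
  have h3 := h1.mul hm h2.1
  have h4 := ha.mul hm h3.1
  have e : source a t u = fun x => a t x * ((1 + u x) * ((1 + u x) * (1 + u x))) := by
    ext x; simp only [source]; ring
  rw [e]
  refine ⟨h4.1, ?_⟩
  rw [h4.2, h3.2, h2.2, (memH_const m 1).enc_add hu, cubic]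

/-- Lipschitz continuity of the equation whose source is truncated at radius `R`. -/
theorem lipschitzWith_truncated {κ ε R t : ℝ} (hκ : 0 ≤ κ) (ht : 0 ≤ t) (hR : 0 < R) (hε : 0 ≤ ε)
    {A : Seq} (hA : ‖A‖ ≤ ε) :
    LipschitzWith (Real.toNNReal (κ + κ ^ 2 + 1 + cubicConst hm R * ε * 2))
      fun W => rhs κ t W (cubic hm A (retr R (posPart (evol (-t) W)))) := by
  have hC := (cubicConst_pos hm hR.le).le
  refine LipschitzWith.of_dist_le_mul fun W W' => ?_
  rw [Real.coe_toNNReal _ (by positivity), dist_eq_norm, dist_eq_norm, rhs_sub]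
  refine (norm_rhs_le hκ ht _ _).trans ?_
  have h1 := norm_cubic_sub_le hm A (norm_retr_le hR (posPart (evol (-t) W)))
    (norm_retr_le hR (posPart (evol (-t) W')))
  have h2 := norm_retr_sub_le hR (posPart (evol (-t) W)) (posPart (evol (-t) W'))
  rw [← map_sub, ← map_sub] at h2
  have h3 := norm_posPart_le (evol (-t) (W - W'))
  rw [norm_evol] at h3
  have h4 : cubicConst hm R * ‖A‖ * ‖retr R (posPart (evol (-t) W)) -
      retr R (posPart (evol (-t) W'))‖ ≤ cubicConst hm R * ε * (2 * ‖W - W'‖) := by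
    gcongr
    linarith
  linarith

end Cubic

/-! ### The state of a solution -/

theorem reflect_reflect (x : Seq) : reflect (reflect x) = x := Seq.ext fun k => by
  rw [reflect_apply, reflect_apply, neg_neg, Complex.conj_conj]

theorem norm_reflect (x : Seq) : ‖reflect x‖ = ‖x‖ :=
  le_antisymm (norm_reflect_le x) (by
    conv_lhs => rw [← reflect_reflect x]
    exact norm_reflect_le _)

theorem reflect_mulI (x : Seq) : reflect (mulI x) = -mulI (reflect x) := by
  rw [← sub_eq_zero, sub_neg_eq_add]
  refine Seq.ext fun k => ?_
  rw [Seq.add_apply, reflect_apply, mulI_apply, mulI_apply, reflect_apply, map_mul,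
    Complex.conj_I, Seq.zero_apply]
  ring

theorem reflect_lam (x : Seq) : reflect (lam x) = lam (reflect x) := Seq.ext fun k => by
  rw [reflect_apply, lam_apply, lam_apply, reflect_apply, map_mul, Complex.conj_ofReal, bracket_neg]

theorem reflect_lapDiag (x : Seq) : reflect (lapDiag x) = lapDiag (reflect x) :=
  Seq.ext fun k => by
    rw [reflect_apply, lapDiag_apply, lapDiag_apply, reflect_apply, map_mul, Complex.conj_ofReal,
      bracket_neg, normSq_neg]

theorem reflect_offProj (x : Seq) : reflect (offProj x) = offProj (reflect x) :=
  Seq.ext fun k => by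
    rw [reflect_apply, offProj_apply, offProj_apply, reflect_apply, map_mul]
    by_cases h : k = 0 <;> simp [h]

theorem mulI_mulI (x : Seq) : mulI (mulI x) = -x := by
  rw [← sub_eq_zero, sub_neg_eq_add]
  refine Seq.ext fun k => ?_
  rw [Seq.add_apply, mulI_apply, mulI_apply, Seq.zero_apply, ← mul_assoc, Complex.I_mul_I]
  ring

theorem norm_mulI (x : Seq) : ‖mulI x‖ = ‖x‖ :=
  le_antisymm (norm_mulI_le x) (by
    have := norm_mulI_le (mulI x)
    rwa [mulI_mulI, norm_neg] at this)

/-- Real and imaginary parts are orthogonal. -/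
theorem norm_add_mulI_sq {x y : Seq} (hx : reflect x = x) (hy : reflect y = y) :
    ‖x + mulI y‖ ^ 2 = ‖x‖ ^ 2 + ‖y‖ ^ 2 := by
  have h1 : ‖x - mulI y‖ = ‖x + mulI y‖ := by
    rw [← norm_reflect (x + mulI y), map_add, reflect_mulI, hx, hy, sub_eq_add_neg]
  have h2 := parallelogram_law_with_norm ℝ x (mulI y)
  rw [h1, norm_mulI] at h2
  nlinarith

/-- The real part of a state. -/
def symPart (Z : Seq) : Seq := (1 / 2 : ℝ) • (Z + reflect Z)

/-- The imaginary part of a state. -/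
def asymPart (Z : Seq) : Seq := (-(1 / 2) : ℝ) • mulI (Z - reflect Z)

theorem lam_symPart (Z : Seq) : lam (symPart Z) = posPart Z := rfl

theorem reflect_symPart (Z : Seq) : reflect (symPart Z) = symPart Z := by
  rw [symPart, map_smul, map_add, reflect_reflect, add_comm]

theorem reflect_asymPart (Z : Seq) : reflect (asymPart Z) = asymPart Z := by
  rw [asymPart, map_smul, reflect_mulI, map_sub, reflect_reflect, ← map_neg, neg_sub]

theorem symPart_add_mulI_asymPart (Z : Seq) : symPart Z + mulI (asymPart Z) = Z := by
  rw [symPart, asymPart, map_smul, mulI_mulI]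
  module

theorem symPart_add_mulI {x y : Seq} (hx : reflect x = x) (hy : reflect y = y) :
    symPart (x + mulI y) = x := by
  rw [symPart, map_add, reflect_mulI, hx, hy]
  module

theorem asymPart_apply (Z : Seq) (k : Freq) :
    asymPart Z k = (-(1 / 2) : ℝ) * (Complex.I * (Z k - starRingEnd ℂ (Z (-k)))) := by
  rw [asymPart, Seq.smul_apply, mulI_apply, Seq.sub_apply, reflect_apply]

/-- The diagonalised unknown `ω u + i (∂_t u + κ u)`, in weighted coefficients. -/
def stateOf (κ m : ℝ) (u ut : Torus → ℝ) : Seq :=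
  enc (m + 1) u + mulI (enc m fun x => ut x + κ * u x)

theorem memH_velocity (κ : ℝ) {m : ℝ} {u ut : Torus → ℝ} (hu : MemH (m + 1) u)
    (hut : MemH m ut) : MemH m fun x => ut x + κ * u x :=
  hut.add ((hu.mono (by linarith)).const_mul κ)

theorem enc_velocity (κ : ℝ) {m : ℝ} {u ut : Torus → ℝ} (hu : MemH (m + 1) u)
    (hut : MemH m ut) : (enc m fun x => ut x + κ * u x) = enc m ut + κ • enc m u := by
  rw [hut.enc_add ((hu.mono (by linarith)).const_mul κ), (hu.mono (by linarith)).enc_const_mul]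

/-- Both components are encodings of real functions, so the symmetric part of the state isolates ωu,
and ω⁻¹ returns u at level m. -/
theorem posPart_stateOf (κ : ℝ) {m : ℝ} {u ut : Torus → ℝ} (hu : MemH (m + 1) u)
    (hut : MemH m ut) : posPart (stateOf κ m u ut) = enc m u := by
  rw [← lam_symPart, stateOf, symPart_add_mulI hu.reflect_enc (memH_velocity κ hu hut).reflect_enc,
    hu.lam_enc]

theorem MemH.enc_homPart {s : ℝ} {u : Torus → ℝ} (hu : MemH s u) :
    enc s (DampedWave.homPart u) = offProj (enc s u) := Seq.ext fun k => by
  rw [hu.homPart.enc_apply, offProj_apply, hu.enc_apply, coeff_homPart hu.1]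
  split_ifs <;> simp

/-- Summing the squares of the symbols i k_j gives |k|², which equals ω² off the zero mode. The full
gradient is therefore exactly one more power of ω. -/
theorem sum_hNorm_pderiv {m : ℝ} {u : Torus → ℝ} (hm : 3 / 2 < m) (hu : MemH (m + 1) u) :
    ∑ j, hNorm m (pderiv j (homPart u)) ^ 2 = ‖offProj (enc (m + 1) u)‖ ^ 2 := by
  have h1 (j : Fin 3) : MemH m (pderiv j (homPart u)) := by
    simpa using hu.homPart.pderiv (by linarith) j
  have h2 : HasSum (fun k => ∑ j, ‖enc m (pderiv j (homPart u)) k‖ ^ 2)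
      (∑ j, hNorm m (pderiv j (homPart u)) ^ 2) :=
    hasSum_sum fun j _ => (h1 j).norm_enc ▸ hasSum_norm_sq _
  refine h2.unique ((hasSum_norm_sq _).congr_fun fun k => ?_)
  rw [← hu.enc_homPart, hu.homPart.enc_apply]
  have h3 (j : Fin 3) : ‖enc m (pderiv j (homPart u)) k‖ ^ 2 =
      (k j : ℝ) ^ 2 * ((bracket k ^ m) ^ 2 * ‖coeff (homPart u) k‖ ^ 2) := by
    rw [(h1 j).enc_apply, hu.homPart.coeff_pderiv (by linarith), norm_mul, norm_mul, norm_mul,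
      Complex.norm_I, Complex.norm_real, show (k j : ℂ) = ((k j : ℝ) : ℂ) by push_cast; rfl,
      Complex.norm_real, Real.norm_eq_abs, Real.norm_eq_abs, mul_pow, mul_pow, mul_pow, sq_abs,
      sq_abs]
    ring
  simp only [h3, ← Finset.sum_mul]
  rw [norm_mul, Complex.norm_real, Real.norm_eq_abs, mul_pow, sq_abs, coeff_homPart hu.1,
    Real.rpow_add_one (bracket_pos k).ne', mul_pow]
  by_cases hk : k = 0
  · simp [hk]
  · rw [bracket_sq hk, normSq]; ring

/-- Orthogonality of real and imaginary parts gives an exact identity, not merely an equivalence of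
norms; this is what yields E(T) ≤ E(0) without loss of a constant. -/
theorem energy_eq (κ : ℝ) {m : ℝ} (hm : 3 / 2 < m) {u ut : Torus → ℝ}
    (hu : MemH (m + 1) u) (hut : MemH m ut) :
    energy κ m u ut = ‖offProj (stateOf κ m u ut)‖ ^ 2 := by
  have hv := memH_velocity κ hu hut
  have hh : (fun x => homPart ut x + κ * homPart u x) = homPart fun x => ut x + κ * u x := by
    refine (hut.homPart.add ((hu.mono (by linarith)).homPart.const_mul κ)).eq_of_coeff_eq hm
      hv.homPart fun k => ?_
    rw [coeff_add hut.homPart.1 (hu.homPart.const_mul κ).1, coeff_const_mul,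
      coeff_homPart hv.1, coeff_homPart hut.1, coeff_homPart hu.1,
      coeff_add hut.1 (hu.const_mul κ).1, coeff_const_mul]
    split_ifs <;> simp
  rw [energy, sum_hNorm_pderiv hm hu, hh, ← hv.homPart.norm_enc, hv.enc_homPart, stateOf, map_add,
    offProj_mulI, norm_add_mulI_sq, add_comm]
  · rw [reflect_offProj, hu.reflect_enc]
  · rw [reflect_offProj, hv.reflect_enc]

theorem eq_of_stateOf_eq {κ m : ℝ} (hm : 3 / 2 < m) {u ut : Torus → ℝ}
    (hu : MemH (m + 1) u) (hut : MemH m ut) {v vt : Torus → ℝ} (hv : MemH (m + 1) v)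
    (hvt : MemH m vt) (h : stateOf κ m u ut = stateOf κ m v vt) : u = v ∧ ut = vt := by
  have h1 : u = v := (hu.mono (by linarith)).eq_of_enc_eq hm (hv.mono (by linarith))
    (by rw [← posPart_stateOf κ hu hut, h, posPart_stateOf κ hv hvt])
  subst h1
  refine ⟨rfl, hut.eq_of_enc_eq hm hvt ?_⟩
  have h2 := congrArg mulI (add_left_cancel h)
  rw [mulI_mulI, mulI_mulI, neg_inj, enc_velocity κ hu hut, enc_velocity κ hu hvt] at h2
  exact add_right_cancel h2

theorem bracket_sq_eq (k : Freq) : bracket k ^ 2 = normSq k + if k = 0 then 1 else 0 := by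
  split_ifs with h
  · simp [h, bracket_zero, normSq_zero]
  · rw [bracket_sq h, add_zero]

theorem Icc_subset_timeInterval {T : EReal} {b : ℝ} (hb : (b : EReal) < T) :
    Set.Icc 0 b ⊆ timeInterval T := fun _ ht =>
  ⟨ht.1, (EReal.coe_le_coe_iff.mpr ht.2).trans_lt hb⟩

/-- Along a solution, the state in the interaction picture solves the diagonalised equation. -/
theorem IsSolution.hasDerivWithinAt {κ m : ℝ} (hm : 5 / 2 < m) {a : ℝ → Torus → ℝ}
    {f g : Torus → ℝ} {T : EReal} {u ut : ℝ → Torus → ℝ} (ha : ContH m (Set.Ici 0) a)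
    (h : IsSolution κ m a f g T u ut) {b : ℝ} (hb0 : 0 ≤ b) (hb : (b : EReal) < T) :
    ∀ t ∈ Set.Icc 0 b, HasDerivWithinAt (fun t => evol t (stateOf κ m (u t) (ut t)))
      (rhs κ t (evol t (stateOf κ m (u t) (ut t)))
        (cubic (by linarith : 3 / 2 < m) (enc m (a t)) (enc m (u t)))) (Set.Icc 0 b) t := by
  have hm' : 3 / 2 < m := by linarith
  have hsub := Icc_subset_timeInterval hb
  obtain ⟨utt, huttc, huttd, heq⟩ := h.equation
  have hu1 (t : ℝ) (ht : t ∈ timeInterval T) : MemH (m + 1) (u t) := h.cont.1 t ht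
  have hu (t : ℝ) (ht : t ∈ timeInterval T) : MemH m (u t) := (hu1 t ht).mono (by linarith)
  have hut (t : ℝ) (ht : t ∈ timeInterval T) : MemH m (ut t) := h.cont_deriv.1 t ht
  have hutt (t : ℝ) (ht : t ∈ timeInterval T) : MemH (m - 1) (utt t) := huttc.1 t ht
  have hut' (t : ℝ) (ht : t ∈ timeInterval T) : MemH (m - 1) (ut t) :=
    (hut t ht).mono (by linarith)
  have hd1 := (hasTimeDeriv_iff hu hut).mp h.hasDeriv
  have hd2 := (hasTimeDeriv_iff hut' hutt).mp huttd
  have hcu1 : ContinuousOn (fun t => enc (m + 1) (u t)) (Set.Icc 0 b) :=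
    h.cont.continuousOn_enc.mono hsub
  have hcu : ContinuousOn (fun t => enc m (u t)) (Set.Icc 0 b) :=
    fun t ht => (hd1 t (hsub ht)).continuousWithinAt.mono hsub
  have hcut : ContinuousOn (fun t => enc m (ut t)) (Set.Icc 0 b) :=
    h.cont_deriv.continuousOn_enc.mono hsub
  have hcZ : ContinuousOn (fun t => stateOf κ m (u t) (ut t)) (Set.Icc 0 b) := by
    have h1 : ContinuousOn (fun t => enc m (ut t) + κ • enc m (u t)) (Set.Icc 0 b) :=
      hcut.add (hcu.const_smul κ)
    refine (hcu1.add (mulI.continuous.comp_continuousOn h1)).congr fun t ht => ?_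
    rw [stateOf, enc_velocity κ (hu1 t (hsub ht)) (hut t (hsub ht))]
    rfl
  have hcW : ContinuousOn (fun t => evol t (stateOf κ m (u t) (ut t))) (Set.Icc 0 b) :=
    continuousOn_evol (t' := fun t => t) continuousOn_id hcZ
  have hcA : ContinuousOn (fun t => enc m (a t)) (Set.Icc 0 b) :=
    ha.continuousOn_enc.mono Set.Icc_subset_Ici_self
  have hcF : ContinuousOn (fun t => cubic hm' (enc m (a t)) (enc m (u t))) (Set.Icc 0 b) :=
    (continuous_cubic hm').comp_continuousOn (hcA.prodMk hcu)
  -- The second time derivative lives only in H^{m-1}, one order below the level of the state.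
  -- Differentiation is therefore done at each single frequency, and the continuity of the right
  -- side upgrades it to norm differentiability.
  refine hasDerivWithinAt_of_apply hb0 (continuousOn_rhs hcW hcF) fun k t ht => ?_
  have hsrc := enc_source hm' a (ha.1 t ht.1) (hu t (hsub ht))
  have hcoef := (equation_iff hm (hu1 t (hsub ht)) (hut t (hsub ht)) (hutt t (hsub ht))
    hsrc.1).mp (heq t (hsub ht)) k
  have hp : HasDerivWithinAt (fun t => enc m (u t) k) (enc m (ut t) k) (Set.Icc 0 b) t :=
    ((evalCLM k).hasFDerivAt.comp_hasDerivWithinAt t (hd1 t (hsub ht))).mono hsub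
  have hq : HasDerivWithinAt (fun t => enc (m - 1) (ut t) k) (enc (m - 1) (utt t) k)
      (Set.Icc 0 b) t :=
    ((evalCLM k).hasFDerivAt.comp_hasDerivWithinAt t (hd2 t (hsub ht))).mono hsub
  have hbk := bracket_pos k
  have hshift (s : ℝ) : bracket k ^ (s + 1) = bracket k * bracket k ^ s := by
    rw [Real.rpow_add_one hbk.ne', mul_comm]
  have hshift' : bracket k ^ m = bracket k * bracket k ^ (m - 1) := by
    rw [← hshift]; congr 1; ring
  have hq' (τ : ℝ) (hτ : τ ∈ Set.Icc 0 b) :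
      enc m (ut τ) k = bracket k * enc (m - 1) (ut τ) k := by
    rw [(hut τ (hsub hτ)).enc_apply, (hut' τ (hsub hτ)).enc_apply, hshift']
    push_cast; ring
  have hZ (τ : ℝ) (hτ : τ ∈ Set.Icc 0 b) : stateOf κ m (u τ) (ut τ) k =
      bracket k * enc m (u τ) k + Complex.I * (bracket k * enc (m - 1) (ut τ) k +
        κ * enc m (u τ) k) := by
    rw [stateOf, enc_velocity κ (hu1 τ (hsub hτ)) (hut τ (hsub hτ)), Seq.add_apply, mulI_apply,
      Seq.add_apply, Seq.smul_apply, ← hq' τ hτ, (hu1 τ (hsub hτ)).enc_apply,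
      (hu τ (hsub hτ)).enc_apply, hshift]
    push_cast; ring
  have hexp : HasDerivAt (fun t : ℝ => Complex.exp (Complex.I * (t * bracket k : ℝ)))
      (Complex.exp (Complex.I * (t * bracket k : ℝ)) * (Complex.I * bracket k)) t := by
    have h1 := (Complex.ofRealCLM.hasDerivAt (x := t)).const_mul (Complex.I * bracket k)
    simp only [Complex.ofRealCLM_apply, Complex.ofReal_one, mul_one] at h1
    refine HasDerivAt.cexp (h1.congr_of_eventuallyEq (Eventually.of_forall fun τ => ?_))
    push_cast; ring
  have hmain := hexp.hasDerivWithinAt.mul ((hp.const_mul (bracket k : ℂ)).add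
    (((hq.const_mul (bracket k : ℂ)).add (hp.const_mul (κ : ℂ))).const_mul Complex.I))
  refine (hmain.congr_of_mem (fun τ hτ => ?_) ht).congr_deriv ?_
  · rw [evol_apply, hZ τ hτ]; rfl
  · have hE : (bracket k : ℂ) * enc (m - 1) (utt t) k + 2 * κ * enc m (ut t) k +
        normSq k * enc m (u t) k = Real.exp (-κ * t) *
          cubic hm' (enc m (a t)) (enc m (u t)) k := by
      rw [← hsrc.2, hsrc.1.enc_apply, (hutt t (hsub ht)).enc_apply, (hut t (hsub ht)).enc_apply,
        (hu t (hsub ht)).enc_apply, mul_left_comm (Real.exp (-κ * t) : ℂ), ← hcoef, hshift']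
      push_cast; ring
    have hsq : (bracket k : ℂ) ^ 2 = normSq k + if k = 0 then 1 else 0 := by
      have := congrArg (fun r : ℝ => (r : ℂ)) (bracket_sq_eq k)
      simp only [Complex.ofReal_pow, Complex.ofReal_add] at this
      rw [this]; split_ifs <;> simp
    rw [rhs_apply, evol_neg_evol, posPart_stateOf κ (hu1 t (hsub ht)) (hut t (hsub ht)), ← hE,
      evol_apply, hZ t ht, hq' t ht]
    simp only [Pi.add_apply]
    linear_combination (Complex.exp (Complex.I * (t * bracket k : ℝ)) * Complex.I *
      enc m (u t) k) * hsq + (Complex.exp (Complex.I * (t * bracket k : ℝ)) * bracket k *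
      (bracket k * enc (m - 1) (ut t) k + κ * enc m (u t) k)) * Complex.I_sq

/-- Solutions are determined by their data. -/
theorem IsSolution.unique {κ m : ℝ} (hκ : 0 ≤ κ) (hm : 5 / 2 < m) {a : ℝ → Torus → ℝ}
    {f g : Torus → ℝ} {T T' : EReal} {u ut v vt : ℝ → Torus → ℝ} (ha : ContH m (Set.Ici 0) a)
    (h : IsSolution κ m a f g T u ut) (h' : IsSolution κ m a f g T' v vt) {t : ℝ}
    (ht0 : 0 ≤ t) (ht : (t : EReal) < T) (ht' : (t : EReal) < T') : u t = v t ∧ ut t = vt t := by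
  have hm' : 3 / 2 < m := by linarith
  have hsub := Icc_subset_timeInterval ht
  have hsub' := Icc_subset_timeInterval ht'
  obtain ⟨ε, hε⟩ := isCompact_Icc.exists_bound_of_continuousOn
    (ha.continuousOn_enc.mono (Set.Icc_subset_Ici_self : Set.Icc 0 t ⊆ Set.Ici 0))
  have hε0 : 0 ≤ ε := (norm_nonneg _).trans (hε 0 ⟨le_rfl, ht0⟩)
  have hbd {S : EReal} {w wt : ℝ → Torus → ℝ} (hw : IsSolution κ m a f g S w wt)
      (hsub : Set.Icc 0 t ⊆ timeInterval S) : ∃ C, ∀ τ ∈ Set.Icc 0 t, ‖enc m (w τ)‖ ≤ C := by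
    refine isCompact_Icc.exists_bound_of_continuousOn fun τ hτ => ?_
    exact (((hasTimeDeriv_iff (fun τ hτ => (hw.cont.1 τ hτ).mono (by linarith))
      hw.cont_deriv.1).mp hw.hasDeriv) τ (hsub hτ)).continuousWithinAt.mono hsub
  obtain ⟨C, hC⟩ := hbd h hsub
  obtain ⟨C', hC'⟩ := hbd h' hsub'
  -- Both solutions stay in this ball on [0, t], so both satisfy the same equation truncated at
  -- radius R, which is globally Lipschitz.
  set R := max 1 (max C C')
  have hR : 0 < R := lt_max_of_lt_left one_pos
  have hsol {S : EReal} {w wt : ℝ → Torus → ℝ} (hw : IsSolution κ m a f g S w wt)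
      (hS : (t : EReal) < S) (hwR : ∀ τ ∈ Set.Icc 0 t, ‖enc m (w τ)‖ ≤ R) (τ : ℝ)
      (hτ : τ ∈ Set.Icc 0 t) :
      HasDerivWithinAt (fun τ => evol τ (stateOf κ m (w τ) (wt τ)))
        (rhs κ τ (evol τ (stateOf κ m (w τ) (wt τ))) (cubic hm' (enc m (a τ))
          (retr R (posPart (evol (-τ) (evol τ (stateOf κ m (w τ) (wt τ)))))))) (Set.Icc 0 t) τ := by
    have hτ' := Icc_subset_timeInterval hS hτ
    rw [evol_neg_evol, posPart_stateOf κ (hw.cont.1 τ hτ') (hw.cont_deriv.1 τ hτ'),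
      retr_of_norm_le hR (hwR τ hτ)]
    exact hw.hasDerivWithinAt hm ha ht0 hS τ hτ
  have key := eqOn_of_lipschitz
    (G := fun τ W => rhs κ τ W (cubic hm' (enc m (a τ)) (retr R (posPart (evol (-τ) W)))))
    (fun τ hτ => lipschitzWith_truncated hm' hκ hτ.1 hR hε0 (hε τ hτ))
    (hsol h ht fun τ hτ => (hC τ hτ).trans ((le_max_left _ _).trans (le_max_right _ _)))
    (hsol h' ht' fun τ hτ => (hC' τ hτ).trans ((le_max_right _ _).trans (le_max_right _ _)))
    (by simp only [h.init, h.init_deriv, h'.init, h'.init_deriv])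
  have htt : t ∈ Set.Icc 0 t := ⟨ht0, le_rfl⟩
  have h1 := congrArg (evol (-t)) (key htt)
  simp only [evol_neg_evol] at h1
  exact eq_of_stateOf_eq hm' (h.cont.1 t (hsub htt)) (h.cont_deriv.1 t (hsub htt))
    (h'.cont.1 t (hsub' htt)) (h'.cont_deriv.1 t (hsub' htt)) h1

/-! ### Solutions from the diagonalised equation -/

theorem timeInterval_top : timeInterval ⊤ = Set.Ici 0 :=
  Set.ext fun t => ⟨fun h => h.1, fun h => ⟨h, EReal.coe_lt_top t⟩⟩

theorem hasDerivWithinAt_Ici_of_apply {y v : ℝ → Seq} (hv : ContinuousOn v (Set.Ici 0))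
    (h : ∀ k, ∀ t, 0 ≤ t → HasDerivWithinAt (fun t => y t k) (v t k) (Set.Ici 0) t) :
    ∀ t, 0 ≤ t → HasDerivWithinAt y (v t) (Set.Ici 0) t := fun t ht => by
  have h1 := hasDerivWithinAt_of_apply (y := y) (b := t + 1) (by linarith)
    (hv.mono Set.Icc_subset_Ici_self)
    (fun k τ hτ => (h k τ hτ.1).mono Set.Icc_subset_Ici_self) t ⟨ht, by linarith⟩
  refine h1.mono_of_mem_nhdsWithin ?_
  rw [← Set.Ici_inter_Iic]
  exact inter_mem self_mem_nhdsWithin (mem_nhdsWithin_of_mem_nhds (Iic_mem_nhds (by linarith)))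

section Diagonal

variable {κ t : ℝ} {W F : ℝ → Seq}

/-- The weighted coefficients of the time derivative, as a function of the state. -/
def velPart (κ : ℝ) (Z : Seq) : Seq := asymPart Z - κ • posPart Z

theorem reflect_velPart (κ : ℝ) (Z : Seq) : reflect (velPart κ Z) = velPart κ Z := by
  rw [velPart, map_sub, map_smul, reflect_asymPart, reflect_posPart]

theorem conj_of_reflect_eq {x : Seq} (hx : reflect x = x) (k : Freq) :
    starRingEnd ℂ (x (-k)) = x k := by
  rw [← reflect_apply, hx]

/-- The source and the recovered u are Hermitian, so conjugating the equation at -k reproduces their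
terms at k with the sign of i reversed. Sums and differences with the equation at k then give the
equations for u and ∂_t u. -/
theorem hasDeriv_conj_evol_neg {I : Set ℝ}
    (hW : HasDerivWithinAt W (rhs κ t (W t) (F t)) I t) (hF : reflect (F t) = F t) (k : Freq) :
    HasDerivWithinAt (fun t => starRingEnd ℂ (evol (-t) (W t) (-k)))
      (Complex.I * bracket k * starRingEnd ℂ (evol (-t) (W t) (-k)) -
        κ * starRingEnd ℂ (evol (-t) (W t) (-k)) - Complex.I *
      (κ ^ 2 * posPart (evol (-t) (W t)) k +
        (if k = 0 then 1 else 0) * posPart (evol (-t) (W t)) k +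
        Real.exp (-κ * t) * F t k)) I t := by
  refine (Complex.conjCLE.hasFDerivAt.comp_hasDerivWithinAt t
    (hasDeriv_evol_neg hW (-k))).congr_deriv ?_
  change starRingEnd ℂ _ = _
  have hif : (starRingEnd ℂ) (if k = 0 then (1 : ℂ) else 0) = if k = 0 then 1 else 0 := by
    split_ifs <;> simp
  simp only [map_sub, map_add, map_mul, map_neg, map_pow, Complex.conj_I, Complex.conj_ofReal,
    bracket_neg, conj_of_reflect_eq (reflect_posPart _), conj_of_reflect_eq hF, neg_eq_zero, hif]
  ring

theorem posPart_apply' (Z : Seq) (k : Freq) :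
    bracket k * posPart Z k = (1 / 2 : ℝ) * (Z k + starRingEnd ℂ (Z (-k))) := by
  have : (bracket k : ℂ) ≠ 0 := Complex.ofReal_ne_zero.mpr (bracket_pos k).ne'
  rw [posPart_apply]
  push_cast
  field_simp

theorem hasDeriv_posPart {I : Set ℝ} (hW : HasDerivWithinAt W (rhs κ t (W t) (F t)) I t)
    (hF : reflect (F t) = F t) (k : Freq) :
    HasDerivWithinAt (fun t => posPart (evol (-t) (W t)) k)
      (velPart κ (evol (-t) (W t)) k) I t := by
  simp only [posPart_apply]
  refine ((((hasDeriv_evol_neg hW k).add (hasDeriv_conj_evol_neg hW hF k)).const_mul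
    ((1 / 2 : ℝ) : ℂ)).const_mul (((bracket k)⁻¹ : ℝ) : ℂ)).congr_deriv ?_
  have hb : (bracket k : ℂ) ≠ 0 := Complex.ofReal_ne_zero.mpr (bracket_pos k).ne'
  rw [velPart, Seq.sub_apply, Seq.smul_apply, asymPart_apply]
  rw [posPart_apply]
  push_cast
  field_simp
  ring

theorem hasDeriv_velPart {I : Set ℝ} (hW : HasDerivWithinAt W (rhs κ t (W t) (F t)) I t)
    (hF : reflect (F t) = F t) (k : Freq) :
    HasDerivWithinAt (fun t => velPart κ (evol (-t) (W t)) k)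
      (-normSq k * posPart (evol (-t) (W t)) k - 2 * κ * velPart κ (evol (-t) (W t)) k +
        Real.exp (-κ * t) * F t k) I t := by
  have h1 := (((hasDeriv_evol_neg hW k).sub (hasDeriv_conj_evol_neg hW hF k)).const_mul
    Complex.I).const_mul ((-(1 / 2) : ℝ) : ℂ)
  have h2 := h1.sub ((hasDeriv_posPart hW hF k).const_mul (κ : ℂ))
  have e (Z : Seq) : velPart κ Z k = ((-(1 / 2) : ℝ) : ℂ) * (Complex.I *
      (Z k - starRingEnd ℂ (Z (-k)))) - κ * posPart Z k := by
    rw [velPart, Seq.sub_apply, Seq.smul_apply, asymPart_apply]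
  simp only [e] at h2 ⊢
  refine h2.congr_deriv ?_
  have hsq : (bracket k : ℂ) ^ 2 = normSq k + if k = 0 then 1 else 0 := by
    have := congrArg (fun r : ℝ => (r : ℂ)) (bracket_sq_eq k)
    simp only [Complex.ofReal_pow, Complex.ofReal_add] at this
    rw [this]; split_ifs <;> simp
  have hp := posPart_apply' (evol (-t) (W t)) k
  generalize evol (-t) (W t) k = z at *
  generalize starRingEnd ℂ (evol (-t) (W t) (-k)) = z' at *
  generalize posPart (evol (-t) (W t)) k = p at *
  push_cast at hp ⊢
  -- The κ²u terms cancel when the derivative of κu is removed, and ω² = |k|² + 1_{k=0} absorbs the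
  -- zero-mode correction.
  linear_combination (-p) * hsq + bracket k * hp + ((1 / 2) * bracket k * (z + z') -
    κ ^ 2 * p - (if k = 0 then 1 else 0) * p - Complex.exp (-κ * t) * F t k) * Complex.I_sq

end Diagonal

/-- A solution of the diagonalised equation yields a solution of the wave equation. -/
theorem exists_isSolution {κ m : ℝ} (hm : 5 / 2 < m) (hm' : 3 / 2 < m) {a : ℝ → Torus → ℝ}
    (ha : ContH m (Set.Ici 0) a) {f g : Torus → ℝ} (hf : MemH (m + 1) f) (hg : MemH m g)
    {W : ℝ → Seq} (hW0 : W 0 = stateOf κ m f g)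
    (hW : ∀ t, 0 ≤ t → HasDerivWithinAt W (rhs κ t (W t) (cubic hm' (enc m (a t))
      (posPart (evol (-t) (W t))))) (Set.Ici 0) t) :
    ∃ u ut : ℝ → Torus → ℝ, IsSolution κ m a f g ⊤ u ut ∧
      ∀ t, 0 ≤ t → stateOf κ m (u t) (ut t) = evol (-t) (W t) := by
  let Z : ℝ → Seq := fun t => evol (-t) (W t)
  let F : ℝ → Seq := fun t => cubic hm' (enc m (a t)) (posPart (Z t))
  have hu (t : ℝ) := exists_enc_eq (s := m + 1) (by linarith) (reflect_symPart (Z t))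
  choose u hu hue using hu
  have hut (t : ℝ) := exists_enc_eq hm' (reflect_velPart κ (Z t))
  choose ut hut hute using hut
  have hu0 (t : ℝ) : enc m (u t) = posPart (Z t) := by
    rw [← (hu t).lam_enc, hue, lam_symPart]
  have hum (t : ℝ) : MemH m (u t) := (hu t).mono (by linarith)
  have hut1 (t : ℝ) : MemH (m - 1) (ut t) := (hut t).mono (by linarith)
  have hute1 (t : ℝ) : enc (m - 1) (ut t) = lam (velPart κ (Z t)) := by
    have h1 : MemH (m - 1 + 1) (ut t) := by simpa using hut t
    rw [← h1.lam_enc, ← hute, sub_add_cancel]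
  have hsrc (t : ℝ) (ht : 0 ≤ t) : MemH m (source a t (u t)) ∧ enc m (source a t (u t)) = F t := by
    have h1 := enc_source hm' a (ha.1 t ht) (hum t)
    rwa [hu0] at h1
  have hFr (t : ℝ) (ht : 0 ≤ t) : reflect (F t) = F t := by
    rw [← (hsrc t ht).2, (hsrc t ht).1.reflect_enc]
  -- This is the candidate for ∂_t²u, namely -2κ∂_t u + e^{-κt}F + Δu, encoded at level m - 1. There
  -- `lam` lowers the first two terms from level m, and `lapDiag` turns u at level m + 1 into -Δu.
  let R : ℝ → Seq := fun t =>
    lam ((-(2 * κ)) • velPart κ (Z t) + Real.exp (-κ * t) • F t) - lapDiag (symPart (Z t))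
  have hRr (t : ℝ) (ht : 0 ≤ t) : reflect (R t) = R t := by
    simp only [R, map_sub, reflect_lam, map_add, map_smul, reflect_velPart, hFr t ht,
      reflect_lapDiag, reflect_symPart]
  have hutt (t : ℝ) : ∃ v, 0 ≤ t → MemH (m - 1) v ∧ enc (m - 1) v = R t := by
    by_cases ht : 0 ≤ t
    · obtain ⟨v, hv⟩ := exists_enc_eq (s := m - 1) (by linarith) (hRr t ht)
      exact ⟨v, fun _ => hv⟩
    · exact ⟨0, fun h => absurd h ht⟩
  choose utt hutt using hutt
  have hcW : ContinuousOn W (Set.Ici 0) := fun t ht => (hW t ht).continuousWithinAt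
  have hcZ : ContinuousOn Z (Set.Ici 0) := continuousOn_evol continuousOn_neg hcW
  have hcS : ContinuousOn (fun t => symPart (Z t)) (Set.Ici 0) := by
    have h1 : ContinuousOn (fun t => Z t + reflect (Z t)) (Set.Ici 0) :=
      hcZ.add (reflect.continuous.comp_continuousOn hcZ)
    exact h1.const_smul (1 / 2 : ℝ)
  have hcP : ContinuousOn (fun t => posPart (Z t)) (Set.Ici 0) :=
    posPart.continuous.comp_continuousOn hcZ
  have hcV : ContinuousOn (fun t => velPart κ (Z t)) (Set.Ici 0) := by
    have h1 : ContinuousOn (fun t => mulI (Z t - reflect (Z t))) (Set.Ici 0) :=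
      mulI.continuous.comp_continuousOn (hcZ.sub (reflect.continuous.comp_continuousOn hcZ))
    exact (h1.const_smul (-(1 / 2) : ℝ)).sub (hcP.const_smul κ)
  have hcF : ContinuousOn F (Set.Ici 0) :=
    (continuous_cubic hm').comp_continuousOn (ha.continuousOn_enc.prodMk hcP)
  have hcR : ContinuousOn R (Set.Ici 0) := by
    have hexp : ContinuousOn (fun t => Real.exp (-κ * t)) (Set.Ici 0) := by fun_prop
    have h1 : ContinuousOn (fun t => (-(2 * κ)) • velPart κ (Z t) + Real.exp (-κ * t) • F t)
        (Set.Ici 0) := (hcV.const_smul (-(2 * κ))).add (hexp.smul hcF)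
    exact (lam.continuous.comp_continuousOn h1).sub (lapDiag.continuous.comp_continuousOn hcS)
  have hd1 : ∀ t, 0 ≤ t → HasDerivWithinAt (fun t => posPart (Z t)) (velPart κ (Z t))
      (Set.Ici 0) t :=
    hasDerivWithinAt_Ici_of_apply hcV fun k t ht =>
      hasDeriv_posPart (F := F) (hW t ht) (hFr t ht) k
  have hd2 : ∀ t, 0 ≤ t → HasDerivWithinAt (fun t => lam (velPart κ (Z t))) (R t)
      (Set.Ici 0) t :=
    hasDerivWithinAt_Ici_of_apply hcR fun k t ht => by
      simp only [lam_apply]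
      refine ((hasDeriv_velPart (F := F) (hW t ht) (hFr t ht) k).const_mul _).congr_deriv ?_
      have hb : (bracket k : ℂ) ≠ 0 := Complex.ofReal_ne_zero.mpr (bracket_pos k).ne'
      simp only [R, Seq.sub_apply, lam_apply, Seq.add_apply, Seq.smul_apply, lapDiag_apply]
      rw [← lam_symPart, lam_apply]
      push_cast
      field_simp
      ring
  have hst (t : ℝ) : stateOf κ m (u t) (ut t) = Z t := by
    rw [stateOf, enc_velocity κ (hu t) (hut t), hue, hute, hu0, velPart, sub_add_cancel,
      symPart_add_mulI_asymPart]
  have h0 := eq_of_stateOf_eq hm' (hu 0) (hut 0) hf hg ((hst 0).trans (by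
    simp only [Z, hW0]
    refine Seq.ext fun k => ?_
    rw [evol_apply]; simp))
  refine ⟨u, ut, ⟨EReal.zero_lt_top, h0.1, h0.2, ?_, ?_, ?_, utt, ?_, ?_, ?_⟩, fun t _ => hst t⟩
  · rw [timeInterval_top]
    exact contH_of_continuousOn_enc (fun t _ => hu t) (hcS.congr fun t _ => hue t)
  · rw [timeInterval_top]
    exact contH_of_continuousOn_enc (fun t _ => hut t) (hcV.congr fun t _ => hute t)
  · rw [timeInterval_top]
    refine (hasTimeDeriv_iff (fun t _ => hum t) fun t _ => hut t).mpr fun t ht => ?_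
    simpa only [hu0, hute] using hd1 t ht
  · rw [timeInterval_top]
    exact contH_of_continuousOn_enc (fun t ht => (hutt t ht).1)
      (hcR.congr fun t ht => (hutt t ht).2)
  · rw [timeInterval_top]
    refine (hasTimeDeriv_iff (fun t _ => hut1 t) fun t ht => (hutt t ht).1).mpr fun t ht => ?_
    have hR := (hutt t ht).2
    simp only [hute1]
    rw [hR]
    exact hd2 t ht
  · intro t ht
    have ht0 : 0 ≤ t := ht.1
    refine (equation_iff hm (hu t) (hut t) (hutt t ht0).1 (hsrc t ht0).1).mpr fun k => ?_
    have hb : (bracket k : ℂ) ≠ 0 := Complex.ofReal_ne_zero.mpr (bracket_pos k).ne'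
    have hshift : ((bracket k ^ (-(m - 1)) : ℝ) : ℂ) = bracket k * (bracket k ^ (-m) : ℝ) := by
      rw [show -(m - 1) = -m + 1 by ring, Real.rpow_add_one (bracket_pos k).ne']
      push_cast; ring
    rw [(hutt t ht0).1.coeff_eq, (hut t).coeff_eq, (hum t).coeff_eq, (hsrc t ht0).1.coeff_eq,
      (hutt t ht0).2, hute, hu0, (hsrc t ht0).2, hshift]
    simp only [R, Seq.sub_apply, lam_apply, Seq.add_apply, Seq.smul_apply, lapDiag_apply]
    rw [← lam_symPart, lam_apply]
    push_cast
    field_simp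
    ring

/-! ### Global existence for small sources -/

theorem norm_le_norm_zero_add_norm_offProj (x : Seq) : ‖x‖ ≤ ‖x 0‖ + ‖offProj x‖ := by
  have h1 : x = zeroProj x + offProj x := Seq.ext fun k => by
    rw [Seq.add_apply, zeroProj_apply, offProj_apply]
    split_ifs <;> simp
  have h2 : ‖zeroProj x‖ ≤ ‖x 0‖ := by
    refine norm_le_of_sq_le (norm_nonneg _) (hasSum_ite_eq (0 : Freq) (‖x 0‖ ^ 2))
      (fun k => ?_) le_rfl
    rw [zeroProj_apply]
    split_ifs with h <;> simp [h]
  conv_lhs => rw [h1]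
  exact (norm_add_le _ _).trans (by gcongr)

/-- The radius of the ball of admissible sources. -/
def smallness (κ m α β : ℝ) (hm : 3 / 2 < m) : ℝ :=
  min ((κ - κ ^ 2) * α / 2) (κ ^ 2 * (α * (β - 1))) / cubicConst hm (α * β)

theorem exists_global_isSolution {κ m α β : ℝ} (hκ0 : 0 < κ) (hκ1 : κ < 1) (hm : 5 / 2 < m)
    (hm' : 3 / 2 < m) (hβ : 1 < β) (hα : 0 < α) {a : ℝ → Torus → ℝ}
    (ha : ContH m (Set.Ici 0) a) (hsmall : ∀ t, 0 ≤ t → hNorm m (a t) ≤ smallness κ m α β hm')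
    {f g : Torus → ℝ} (hf : MemHom (m + 1) f) (hg : MemHom m g)
    (hE : Real.sqrt (energy κ m f g) = α) :
    ∃ u ut : ℝ → Torus → ℝ, IsSolution κ m a f g ⊤ u ut ∧
      ∀ t, 0 ≤ t → hNorm m (u t) ≤ α * β ∧ energy κ m (u t) (ut t) ≤ α ^ 2 := by
  have hR : 0 < α * β := by positivity
  have hC := cubicConst_pos hm' hR.le
  -- This is the admissible size of the source. The first entry, halved to make the inequality
  -- strict, serves the energy barrier; the second leaves the mean the room α(β-1).
  set η := min ((κ - κ ^ 2) * α / 2) (κ ^ 2 * (α * (β - 1))) with hηdef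
  have hκκ : 0 < κ - κ ^ 2 := by nlinarith
  have hβ1 : 0 < β - 1 := by linarith
  have hη0 : 0 < η := lt_min (by positivity) (by positivity)
  have hη1 : η < (κ - κ ^ 2) * α := (min_le_left _ _).trans_lt (half_lt_self (by positivity))
  have hη2 : η / κ ^ 2 ≤ α * (β - 1) :=
    div_le_of_le_mul₀ (by positivity) (by positivity) (by rw [mul_comm]; exact min_le_right _ _)
  have hε0 : 0 ≤ smallness κ m α β hm' := div_nonneg hη0.le hC.le
  have hA (t : ℝ) (ht : 0 ≤ t) : ‖enc m (a t)‖ ≤ smallness κ m α β hm' := by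
    rw [(ha.1 t ht).norm_enc]; exact hsmall t ht
  let N : ℝ → Seq → Seq := fun t W =>
    cubic hm' (enc m (a t)) (retr (α * β) (posPart (evol (-t) W)))
  obtain ⟨W, hW0, hW⟩ := exists_global_solution (G := fun t W => rhs κ t W (N t W))
    (fun t ht => lipschitzWith_truncated hm' hκ0.le ht hR hε0 (hA t ht))
    (fun x => continuousOn_rhs continuousOn_const ((continuous_cubic hm').comp_continuousOn
      (ha.continuousOn_enc.prodMk ((lipschitzWith_retr hR).continuous.comp_continuousOn
        (continuousOn_posPart_evol continuousOn_const))))) (stateOf κ m f g)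
  have hF (t : ℝ) (ht : 0 ≤ t) : ‖N t (W t)‖ ≤ η := by
    refine (norm_cubic_le hm' _ (norm_retr_le hR _)).trans ?_
    calc cubicConst hm' (α * β) * ‖enc m (a t)‖
        ≤ cubicConst hm' (α * β) * smallness κ m α β hm' := by gcongr; exact hA t ht
      _ = η := by rw [smallness, ← hηdef]; field_simp
  -- The retraction multiplies by a real scalar, so the truncated argument still encodes a real
  -- function, and so does the source built from it.
  have hFr (t : ℝ) (ht : 0 ≤ t) : reflect (N t (W t)) = N t (W t) := by
    have h1 : reflect (retr (α * β) (posPart (evol (-t) (W t)))) =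
        retr (α * β) (posPart (evol (-t) (W t))) := by
      rw [retr, map_smul, reflect_posPart]
    obtain ⟨v, hv, hve⟩ := exists_enc_eq hm' h1
    have h2 := enc_source hm' a (ha.1 t ht) hv
    simp only [N]
    rw [← hve, ← h2.2, h2.1.reflect_enc]
  have hoff0 : ‖offProj (stateOf κ m f g)‖ = α := by
    rw [← hE, energy_eq κ hm' hf.1 hg.1, Real.sqrt_sq (norm_nonneg _)]
  have hoff := norm_offProj_le_of_solution hκ0 hα hη1 hW hF (by rw [hW0, hoff0])
  have hcoeff0 {v : Torus → ℝ} (hv : mean v = 0) : coeff v 0 = 0 := by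
    rw [← mean_eq, hv, Complex.ofReal_zero]
  have hz0 : W 0 0 = 0 := by
    rw [hW0, stateOf, enc_velocity κ hf.1 hg.1, Seq.add_apply, mulI_apply, Seq.add_apply,
      Seq.smul_apply, hf.1.enc_apply, hg.1.enc_apply, (hf.1.mono (by linarith)).enc_apply,
      hcoeff0 hf.2, hcoeff0 hg.2]
    simp
  have hzero := norm_posPart_zero_le_of_solution hκ0 hW hF hFr hz0
  have hU (t : ℝ) (ht : 0 ≤ t) : ‖posPart (evol (-t) (W t))‖ ≤ α * β := by
    have h1 := norm_le_norm_zero_add_norm_offProj (posPart (evol (-t) (W t)))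
    have h2 : ‖offProj (posPart (evol (-t) (W t)))‖ ≤ α := by
      rw [offProj_posPart, offProj_evol]
      refine (norm_posPart_le _).trans ?_
      rw [norm_evol]
      exact hoff t ht
    linarith [hzero t ht]
  -- The recovered u never leaves the ball of radius αβ, so the truncated equation is the original
  -- one. No continuity argument is needed, because the source bound holds for every state after
  -- truncation.
  obtain ⟨u, ut, hsol, hst⟩ := exists_isSolution hm hm' ha hf.1 hg.1 hW0 fun t ht => by
    have h1 := hW t ht
    simp only [N] at h1
    rwa [retr_of_norm_le hR (hU t ht)] at h1
  refine ⟨u, ut, hsol, fun t ht => ?_⟩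
  have htI : t ∈ timeInterval ⊤ := by rw [timeInterval_top]; exact ht
  have hu := hsol.cont.1 t htI
  have hut := hsol.cont_deriv.1 t htI
  constructor
  · rw [← (hu.mono (by linarith)).norm_enc, ← posPart_stateOf κ hu hut, hst t ht]
    exact hU t ht
  · rw [energy_eq κ hm' hu hut, hst t ht, offProj_evol, norm_evol]
    exact pow_le_pow_left₀ (norm_nonneg _) (hoff t ht) 2

end DampedWave

end

theorem mainTheorem2 (κ m α β : ℝ) (hκ0 : 0 < κ) (hκ1 : κ < 1) (hm : 5 / 2 < m)
    (hβ1 : 1 < β) (hβκ : β < 1 / κ) (hα : 0 < α) :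
    ∃ ε : ℝ, 0 < ε ∧
      ∀ (f g : DampedWave.Torus → ℝ) (a : ℝ → DampedWave.Torus → ℝ),
        DampedWave.MemHom (m + 1) f → DampedWave.MemHom m g →
        Real.sqrt (DampedWave.energy κ m f g) = α →
        DampedWave.ContH m (Set.Ici 0) a →
        (∀ t : ℝ, 0 ≤ t → DampedWave.hNorm m (a t) ≤ ε) →
        (∃ (Tmax : EReal) (u ut : ℝ → DampedWave.Torus → ℝ),
          DampedWave.IsMaximalSolution κ m a f g Tmax u ut) ∧
        ∀ (Tmax : EReal) (u ut : ℝ → DampedWave.Torus → ℝ),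
          DampedWave.IsMaximalSolution κ m a f g Tmax u ut →
          DampedWave.Tstar κ m β Tmax u ut = ⊤ := by
  have hm' : 3 / 2 < m := by linarith
  have hκκ : 0 < κ - κ ^ 2 := by nlinarith
  have hβ0 : 0 < β - 1 := by linarith
  refine ⟨DampedWave.smallness κ m α β hm', div_pos (lt_min (by positivity) (by positivity))
    (DampedWave.cubicConst_pos hm' (by positivity)), fun f g a hf hg hE ha hsmall => ?_⟩
  obtain ⟨v, vt, hv, hbound⟩ := DampedWave.exists_global_isSolution hκ0 hκ1 hm hm' hβ1 hα ha
    hsmall hf hg hE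
  refine ⟨⟨⊤, v, vt, hv, fun T _ _ hT => absurd hT not_top_lt⟩, fun Tmax u ut hu => ?_⟩
  have hagree (t : ℝ) (ht : 0 ≤ t) (htT : (t : EReal) < Tmax) : v t = u t ∧ vt t = ut t :=
    hv.unique hκ0.le hm ha hu.1 ht (EReal.coe_lt_top t) htT
  -- If the interval were bounded, the global solution would extend the given one by uniqueness,
  -- against maximality.
  have htop : Tmax = ⊤ := by
    by_contra hne
    exact hu.2 ⊤ v vt (lt_top_iff_ne_top.mpr hne) hv fun t ht => (hagree t ht.1 ht.2).1
  subst htop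
  have hE0 : DampedWave.energy κ m f g = α ^ 2 := by
    rw [← hE, Real.sq_sqrt]
    exact add_nonneg (sq_nonneg _) (Finset.sum_nonneg fun _ _ => sq_nonneg _)
  rw [DampedWave.Tstar, hu.1.init, hu.1.init_deriv, hE, hE0]
  refine (EReal.eq_top_iff_forall_lt _).mpr fun y => ?_
  -- Every nonnegative time is admissible, so this one, which exceeds the arbitrary real y, shows
  -- that the supremum is infinite.
  have hy : 0 ≤ max y 0 + 1 := by positivity
  refine lt_of_lt_of_le (b := ((max y 0 + 1 : ℝ) : EReal))
    (EReal.coe_lt_coe_iff.mpr (by linarith [le_max_left y 0])) (le_sSup ?_)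
  refine ⟨_, rfl, ⟨hy, EReal.coe_lt_top _⟩, fun t ht => ?_, ?_⟩
  · rw [← (hagree t ht.1 (EReal.coe_lt_top t)).1]
    exact (hbound t ht.1).1
  · rw [← (hagree _ hy (EReal.coe_lt_top _)).1, ← (hagree _ hy (EReal.coe_lt_top _)).2]
    exact (hbound _ hy).2
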